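/- Let $k$ be a perfect field of characteristic $p>0$. \textbf{$1$-foliations.} Let $Y$ be a normal scheme of finite type over a field $\kappa$ of characteristic $p$. A coherent subsheaf $\mathcal G\subset T_{Y/\kappa}$ is a \emph{$1$-foliation of rank $r$} if $T_{Y/\kappa}/\mathcal G$ is torsion-free, $\mathcal G$ is closed under Lie brackets and under $p$-th powers of derivations, and $\mathcal G$ has rank $r$ at every generic point of $Y$. \textbf{Families.} Let $S$ be a locally Noetherian $F$-finite $k$-scheme. A \emph{family of $1$-foliations of rank $r$ over $S$} consists of a flat morphism of finite type $f\colon\mathcal X\to S$ and a coherent subsheaf $\mathcal F\subset T_{\mathcal X/S}=\mathcal Der_{\mathcal O_S}(\mathcal O_{\mathcal X})$ such that: (1) the fibers of $f$ are geometrically normal and $f_*\mathcal O_{\mathcal X}=\mathcal O_S$; (2) $T_{\mathcal X/S}$ is flat over $S$ and, for every $s\in S$, restriction of derivations to the fiber identifies $T_{\mathcal X/S}\otimes\kappa(s)$ with $T_{\mathcal X_s/\kappa(s)}$; (3) $T_{\mathcal X/S}/\mathcal F$ is flat over $S$; (4) for every $s\in S$, the image $\mathcal F_s\cong\mathcal F\otimes\kappa(s)$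 of $\mathcal F$ in $T_{\mathcal X_s/\kappa(s)}$ is a $1$-foliation of rank $r$ on $\mathcal X_s$. \textbf{Quotients.} Let $\mathcal O_{\mathcal X}^{\mathcal F}\subset\mathcal O_{\mathcal X}$ be the subsheaf of functions killed by all local sections of $\mathcal F$. The locally ringed space $Z=\mathcal X/\mathcal F:=(|\mathcal X|,\mathcal O_{\mathcal X}^{\mathcal F})$ is a scheme. It comes with the morphism $q\colon\mathcal X\to Z$ which is the identity on points, and $f$ factors as $f=g\circ q$ with $g\colon Z\to S$. The quotients $\mathcal X_s/\mathcal F_s$ of the fibers are defined in the same way. For $s\in S$, functions killed by $\mathcal F$ restrict to functions on $\mathcal X_s$ killed by $\mathcal F_s$, which gives a comparison morphism $\varphi_s\colon\mathcal X_s/\mathcal F_s\to Z_s=Z\times_S\operatorname{Spec}\kappa(s)$: the morphism over $\operatorname{Spec}\kappa(s)$ such that the composition $\mathcal X_s\to\mathcal X_s/\mathcal F_s\xrightarrow{\varphi_s}Z_s\to Z$ equals $\mathcal X_s\to\mathcal X\xrightarrow{q}Z$. \textbf{Multiplicative singularities.} Let $z\in\mathcal X$ and let $\hat A$ be the completion of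 $A=\mathcal O_{\mathcal X,z}$ at its maximal ideal. A continuous $\mathcal O_{S,f(z)}$-linear derivation $D$ of $\hat A$ is \emph{multiplicative} if its $p$-th iterate satisfies $D^{[p]}=uD$ for some unit $u\in\hat A^\times$. One says that $\mathcal F$ has \emph{at worst multiplicative singularities at $z$} if the $\hat A$-submodule $\hat{\mathcal F}_z$ of $\operatorname{Der}^{\mathrm{cont}}_{\mathcal O_{S,f(z)}}(\hat A)$ generated by $\mathcal F_z$ is the saturation of the submodule generated by finitely many multiplicative continuous derivations that commute with each other; that is, a derivation $E$ lies in $\hat{\mathcal F}_z$ if and only if $aE$ lies in that submodule for some non-zero-divisor $a\in\hat A$. \textbf{Proposition.} Let $(f\colon\mathcal X\to S,\ \mathcal F\subset T_{\mathcal X/S})$ be a family of $1$-foliations of rank $r$ over $S$, with $S$ regular, and let $z\in\mathcal X$ be a closed point at which $\mathcal F$ has at worst multiplicative singularities. Put $s=f(z)$. Then $g\colon Z=\mathcal X/\mathcal F\to S$ is flat at $q(z)$, and $\varphi_s\colon\mathcal X_s/\mathcal F_s\to Z_s$ is an isomorphism at $z$ (it restricts to an isomorphism over an open neighbourhood of $\varphi_s(z)$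 in $Z_s$). -/

import Mathlib

universe u
open CategoryTheory AlgebraicGeometry TopologicalSpace Opposite
noncomputable section
namespace Foliation

/-- The local ring of `X` at `x` as an algebra over the local ring of `S` at `f x`. -/
instance stalkAlgebra {X S : Scheme.{u}} (f : X ⟶ S) (x : X) :
    Algebra (S.presheaf.stalk (f x)) (X.presheaf.stalk x) :=
  (f.stalkMap x).hom.toAlgebra

/-- The stalk at `x` of the tangent sheaf `T_{X/S} = Der_{O_S}(O_X, O_X)`: the `O_{S, f x}`-linear
derivations of `O_{X, x}`. (This is the stalk of the sheaf of derivations as soon as `f` is locally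
of finite presentation, for example locally of finite type with `S` locally Noetherian.) -/
abbrev TangentStalk {X S : Scheme.{u}} (f : X ⟶ S) (x : X) : Type u :=
  Derivation (S.presheaf.stalk (f x)) (X.presheaf.stalk x) (X.presheaf.stalk x)

/-- A choice of a submodule of the stalk of `T_{X/S}` at every point of `X`. Such a family is
(the family of stalks of) a coherent subsheaf of `T_{X/S}` if it satisfies `IsCoherent` below. -/
abbrev StalkFamily {X S : Scheme.{u}} (f : X ⟶ S) : Type u :=
  ∀ x : X, Submodule (X.presheaf.stalk x) (TangentStalk f x)

/-- A family of germs of derivations is a section of `T_{X/S}` over `U`: it maps regular functions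
on the open subsets of `U` to regular functions. -/
def IsVectorField {X S : Scheme.{u}} (f : X ⟶ S) (U : X.Opens) (D : ∀ x : X, TangentStalk f x) :
    Prop :=
  ∀ (V : X.Opens), V ≤ U → ∀ a : Γ(X, V), ∃ b : Γ(X, V), ∀ (x : X) (hx : x ∈ V),
    X.presheaf.germ V x hx b = D x (X.presheaf.germ V x hx a)

/-- The family `F` of submodules of the stalks of `T_{X/S}` is the family of stalks of a coherent
subsheaf of `T_{X/S}`: locally it is generated by finitely many sections of `T_{X/S}`. -/
def IsCoherent {X S : Scheme.{u}} {f : X ⟶ S} (F : StalkFamily f) : Prop :=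
  ∀ x : X, ∃ U : X.Opens, x ∈ U ∧ ∃ (n : ℕ) (D : Fin n → ∀ y : X, TangentStalk f y),
    (∀ i, IsVectorField f U (D i)) ∧
    ∀ y ∈ U, F y = Submodule.span (X.presheaf.stalk y) (Set.range fun i => D i y)

/-! The next facts are used to prove that `(|X|, O_X^F)` is a scheme. -/

theorem isIso_toΓSpec (Y : LocallyRingedSpace.{u}) [T0Space Y]
    (h₁ : ∀ (x : Y) (z : Y.presheaf.stalk x), ∃ a b : LocallyRingedSpace.Γ.obj (op Y),
      IsUnit (Y.presheaf.Γgerm x a) ∧ z * Y.presheaf.Γgerm x a = Y.presheaf.Γgerm x b)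
    (h₂ : ∀ (x : Y) (b : LocallyRingedSpace.Γ.obj (op Y)), Y.presheaf.Γgerm x b = 0 →
      ∃ e : LocallyRingedSpace.Γ.obj (op Y), IsUnit (Y.presheaf.Γgerm x e) ∧ e * b = 0)
    (h₃ : ∀ q : PrimeSpectrum (LocallyRingedSpace.Γ.obj (op Y)), ∃ x : Y,
      ∀ b : LocallyRingedSpace.Γ.obj (op Y), b ∉ q.asIdeal ↔ IsUnit (Y.presheaf.Γgerm x b))
    (h₄ : ∀ (x : Y) (V : Opens Y), x ∈ V → ∃ b : LocallyRingedSpace.Γ.obj (op Y),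
      IsUnit (Y.presheaf.Γgerm x b) ∧ ∀ y, IsUnit (Y.presheaf.Γgerm y b) → y ∈ V) :
    IsIso Y.toΓSpec := by
  have hcont : Continuous Y.toΓSpecFun := Y.toΓSpec_continuous
  have hind : Topology.IsInducing Y.toΓSpecFun := by
    rw [Topology.isInducing_iff_nhds]
    intro x
    refine le_antisymm (hcont.tendsto x).le_comap ?_
    intro V hV
    obtain ⟨V', hV'V, hV', hx⟩ := mem_nhds_iff.mp hV
    obtain ⟨b, hb, hb'⟩ := h₄ x ⟨V', hV'⟩ hx
    refine Filter.mem_comap.mpr ⟨PrimeSpectrum.basicOpen b,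
      (PrimeSpectrum.basicOpen b).isOpen.mem_nhds
        ((Y.notMem_prime_iff_unit_in_stalk b x).mpr hb), fun y hy => hV'V ?_⟩
    exact hb' y ((Y.notMem_prime_iff_unit_in_stalk b y).mp hy)
  have hsurj : Function.Surjective Y.toΓSpecFun := by
    intro q
    obtain ⟨x, hx⟩ := h₃ q
    refine ⟨x, PrimeSpectrum.ext (Ideal.ext fun b => not_iff_not.mp ?_)⟩
    exact (Y.notMem_prime_iff_unit_in_stalk b x).trans (hx b).symm
  have hemb : Topology.IsOpenEmbedding Y.toΓSpec.base :=
    ⟨⟨hind, hind.injective⟩, by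
      have : Set.range Y.toΓSpecFun = Set.univ := hsurj.range_eq
      change IsOpen (Set.range Y.toΓSpecFun)
      rw [this]
      exact isOpen_univ⟩
  have hcomp : ∀ (x : Y) (b : LocallyRingedSpace.Γ.obj (op Y)),
      Y.toΓSpec.stalkMap x (algebraMap (LocallyRingedSpace.Γ.obj (op Y))
        ((Spec.structureSheaf (LocallyRingedSpace.Γ.obj (op Y))).presheaf.stalk
          (Y.toΓSpecFun x)) b) = Y.presheaf.Γgerm x b := by
    intro x b
    exact congr($(Y.toStalk_stalkMap_toΓSpec x) b)
  have hst : ∀ x : Y, IsIso (Y.toΓSpec.stalkMap x) := by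
    intro x
    rw [ConcreteCategory.isIso_iff_bijective]
    constructor
    · refine (injective_iff_map_eq_zero (Y.toΓSpec.stalkMap x).hom).mpr ?_
      intro s hs
      obtain ⟨⟨b, d⟩, hbd⟩ := IsLocalization.surj (Y.toΓSpecFun x).asIdeal.primeCompl
        (S := (Spec.structureSheaf (LocallyRingedSpace.Γ.obj (op Y))).presheaf.stalk
          (Y.toΓSpecFun x)) s
      have h5 := congrArg (Y.toΓSpec.stalkMap x).hom hbd
      have h6 : Y.presheaf.Γgerm x b = 0 := by
        rw [← hcomp]
        refine h5.symm.trans ?_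
        refine (map_mul (Y.toΓSpec.stalkMap x).hom _ _).trans ?_
        rw [hs, zero_mul]
      obtain ⟨e, he, heb⟩ := h₂ x b h6
      have hd := IsLocalization.map_units
        ((Spec.structureSheaf (LocallyRingedSpace.Γ.obj (op Y))).presheaf.stalk
          (Y.toΓSpecFun x)) d
      have he' := IsLocalization.map_units
        ((Spec.structureSheaf (LocallyRingedSpace.Γ.obj (op Y))).presheaf.stalk
          (Y.toΓSpecFun x))
        (⟨e, (Y.notMem_prime_iff_unit_in_stalk e x).mpr he⟩ :
          (Y.toΓSpecFun x).asIdeal.primeCompl)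
      refine (hd.mul_left_eq_zero).mp (hbd.trans ((he'.mul_right_eq_zero).mp ?_))
      change algebraMap _ _ e * algebraMap _ _ b = 0
      rw [← map_mul, heb, map_zero]
    · intro z
      obtain ⟨a, b, ha, hab⟩ := h₁ x z
      have ha' := IsLocalization.map_units
        ((Spec.structureSheaf (LocallyRingedSpace.Γ.obj (op Y))).presheaf.stalk
          (Y.toΓSpecFun x))
        (⟨a, (Y.notMem_prime_iff_unit_in_stalk a x).mpr ha⟩ :
          (Y.toΓSpecFun x).asIdeal.primeCompl)
      obtain ⟨v, hv⟩ := ha'.exists_right_inv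
      refine ⟨(algebraMap _ ((Spec.structureSheaf (LocallyRingedSpace.Γ.obj (op Y))).presheaf.stalk
          (Y.toΓSpecFun x)) b * v : (Spec.structureSheaf
            (LocallyRingedSpace.Γ.obj (op Y))).presheaf.stalk (Y.toΓSpecFun x)), ha.mul_right_cancel (Eq.trans ?_ hab.symm)⟩
      rw [← hcomp, ← hcomp]
      refine (map_mul (Y.toΓSpec.stalkMap x).hom _ _).symm.trans ?_
      refine congrArg (Y.toΓSpec.stalkMap x).hom ?_
      change algebraMap _ _ a * v = 1 at hv
      have key : ∀ {R : Type u} [CommRing R] (α β v : R), α * v = 1 → β * v * α = β := by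
        intro R _ α β v h
        rw [mul_assoc, mul_comm v, h, mul_one]
      exact key _ _ _ hv
  have : LocallyRingedSpace.IsOpenImmersion Y.toΓSpec :=
    LocallyRingedSpace.IsOpenImmersion.of_stalk_iso _ hemb
  have : Epi Y.toΓSpec.base := (TopCat.epi_iff_surjective _).mpr hsurj
  exact LocallyRingedSpace.IsOpenImmersion.to_iso _

theorem exists_chart (Z : LocallyRingedSpace.{u}) {U : TopCat.{u}} {g : U ⟶ Z.toTopCat}
    (h : Topology.IsOpenEmbedding g) (hiso : IsIso (Z.restrict h).toΓSpec) (y : U) :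
    ∃ (R : CommRingCat.{u}) (j : Spec.toLocallyRingedSpace.obj (op R) ⟶ Z),
      g y ∈ Set.range j.base ∧ LocallyRingedSpace.IsOpenImmersion j := by
  have hinv : LocallyRingedSpace.IsOpenImmersion (inv (Z.restrict h).toΓSpec) := inferInstance
  have hofr : LocallyRingedSpace.IsOpenImmersion (Z.ofRestrict h) := inferInstance
  let j := inv (Z.restrict h).toΓSpec ≫ Z.ofRestrict h
  have h1 : (Z.restrict h).toΓSpec ≫ j = Z.ofRestrict h := IsIso.hom_inv_id_assoc _ _
  exact ⟨LocallyRingedSpace.Γ.obj (op (Z.restrict h)), j,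
    ⟨(Z.restrict h).toΓSpec.base y, congr(($h1).base y)⟩,
    LocallyRingedSpace.IsOpenImmersion.comp (inv (Z.restrict h).toΓSpec) (Z.ofRestrict h)⟩

theorem exists_mul_eq_zero {X : Scheme.{u}} {U : X.Opens} (hU : IsAffineOpen U) (y : X) (hy : y ∈ U)
    (b : Γ(X, U)) (hb : X.presheaf.germ U y hy b = 0) :
    ∃ a : Γ(X, U), IsUnit (X.presheaf.germ U y hy a) ∧ a * b = 0 := by
  obtain ⟨W, hyW, i, j, hij⟩ := X.presheaf.germ_eq y hy hy b 0 (by rw [hb, map_zero])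
  obtain ⟨a, haW, hya⟩ := hU.exists_basicOpen_le ⟨y, hyW⟩ hy
  have hloc := hU.isLocalization_basicOpen a
  have h0 : X.presheaf.map (homOfLE (X.basicOpen_le a)).op b = 0 := by
    have h1 := congrArg (X.presheaf.map (homOfLE haW).op) hij
    rw [← CategoryTheory.comp_apply, ← CategoryTheory.comp_apply, ← X.presheaf.map_comp,
      ← X.presheaf.map_comp, map_zero] at h1
    exact h1
  obtain ⟨⟨_, k, rfl⟩, hk⟩ := IsLocalization.exists_of_eq (M := Submonoid.powers a)
      (S := Γ(X, X.basicOpen a)) (x := b) (y := 0) (by rw [map_zero]; exact h0)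
  refine ⟨a ^ k, ?_, ?_⟩
  · rw [map_pow]
    exact ((X.mem_basicOpen a y hy).mp hya).pow _
  · exact hk.trans (mul_zero _)

theorem exists_point {X : Scheme.{u}} {U : X.Opens} (hU : IsAffineOpen U)
    (q : PrimeSpectrum Γ(X, U)) :
    ∃ (x : X) (hx : x ∈ U), ∀ a, a ∉ q.asIdeal ↔ IsUnit (X.presheaf.germ U x hx a) := by
  have hx : hU.fromSpec q ∈ U := by
    have : hU.fromSpec q ∈ Set.range hU.fromSpec := ⟨q, rfl⟩
    rwa [hU.range_fromSpec] at this
  refine ⟨hU.fromSpec q, hx, fun a => ?_⟩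
  rw [← X.mem_basicOpen a _ hx]
  have h := hU.fromSpec_preimage_basicOpen a
  have h' : q ∈ hU.fromSpec ⁻¹ᵁ X.basicOpen a ↔ q ∈ PrimeSpectrum.basicOpen a := by
    rw [h]; rfl
  exact h'.symm

theorem exists_prime {A : Type u} [CommRing A] (B : Subring A) (p : ℕ) [hpp : Fact p.Prime]
    (hp : (p : A) = 0) (hB : ∀ a : A, a ^ p ∈ B) (q : PrimeSpectrum B) :
    ∃ q' : PrimeSpectrum A, ∀ b : B, b ∈ q.asIdeal ↔ b.1 ∈ q'.asIdeal := by
  have : Nontrivial B := q.nontrivial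
  have : Nontrivial A := B.subtype_injective.nontrivial
  have : CharP A p := (CharP.charP_iff_prime_eq_zero hpp.out).mpr hp
  refine ⟨PrimeSpectrum.comap ((frobenius A p).codRestrict B hB) q, fun b => ?_⟩
  rw [PrimeSpectrum.comap_asIdeal, Ideal.mem_comap]
  have : (frobenius A p).codRestrict B hB b.1 = b ^ p := Subtype.ext (frobenius_def p b.1)
  rw [this, q.isPrime.pow_mem_iff_mem _ hpp.out.pos]

section quot
variable {X S : Scheme.{u}} {f : X ⟶ S} (F : StalkFamily f)

/-- The ring `O_X^F (U)` of the regular functions on `U` that are killed by all the local sections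
of `F` on open subsets of `U`, equivalently whose germs are killed by the stalks of `F`. -/
def invariants (U : X.Opens) : Subring Γ(X, U) where
  carrier := {a | ∀ (x : X) (hx : x ∈ U), ∀ D ∈ F x, D (X.presheaf.germ U x hx a) = 0}
  mul_mem' := by
    intro a b ha hb x hx D hD
    rw [map_mul, D.leibniz, ha x hx D hD, hb x hx D hD]; simp
  one_mem' := by intro x hx D _; rw [map_one, D.map_one_eq_zero]
  add_mem' := by
    intro a b ha hb x hx D hD
    rw [map_add, map_add, ha x hx D hD, hb x hx D hD, add_zero]
  zero_mem' := by intro x hx D _; rw [map_zero, map_zero]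
  neg_mem' := by
    intro a ha x hx D hD
    rw [map_neg, map_neg, ha x hx D hD, neg_zero]

theorem invariants_res {U V : X.Opens} (i : V ⟶ U) {a : Γ(X, U)} (ha : a ∈ invariants F U) :
    X.presheaf.map i.op a ∈ invariants F V := by
  intro x hx D hD
  rw [TopCat.Presheaf.germ_res_apply]
  exact ha x (i.le hx) D hD

/-- The sheaf `O_X^F` on the topological space of `X`. -/
def quotPresheaf : X.toTopCat.Presheaf CommRingCat.{u} where
  obj U := CommRingCat.of (invariants F U.unop)
  map {U V} i := CommRingCat.ofHom
    (((X.presheaf.map i).hom.comp (invariants F U.unop).subtype).codRestrict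
      (invariants F V.unop) fun a => invariants_res F i.unop a.2)
  map_id U := by
    ext a
    exact congr($(X.presheaf.map_id U) a.1)
  map_comp i j := by
    ext a
    exact congr($(X.presheaf.map_comp i j) a.1)

/-- The inclusion of `O_X^F` in `O_X`. -/
def quotIncl : quotPresheaf F ⟶ X.presheaf where
  app U := CommRingCat.ofHom (invariants F U.unop).subtype
  naturality _ _ _ := rfl

theorem quotPresheaf_isSheaf : (quotPresheaf F).IsSheaf := by
  rw [TopCat.Presheaf.isSheaf_iff_isSheafUniqueGluing]
  intro ι U sf hsf
  obtain ⟨s, hs, hu⟩ := X.sheaf.existsUnique_gluing U (fun i => (sf i).1) (by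
    intro i j
    exact congrArg Subtype.val (hsf i j))
  refine ⟨⟨s, ?_⟩, ?_, ?_⟩
  · intro x hx D hD
    obtain ⟨i, hi⟩ := Opens.mem_iSup.mp hx
    have h1 := (sf i).2 x hi D hD
    have h3 : X.presheaf.map (Opens.leSupr U i).op s = (sf i).1 := hs i
    rw [← h3] at h1
    have h2 : X.presheaf.germ (U i) x hi (X.presheaf.map (Opens.leSupr U i).op s) =
      X.presheaf.germ (iSup U) x hx s := TopCat.Presheaf.germ_res_apply _ _ _ _ _
    rw [← h2]
    exact h1
  · intro i
    apply Subtype.ext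
    exact hs i
  · intro t ht
    apply Subtype.ext
    apply hu
    intro i
    exact congrArg Subtype.val (ht i)

def quotPresheafedSpace : PresheafedSpace CommRingCat.{u} where
  carrier := X.toTopCat
  presheaf := quotPresheaf F

def quotProjPresheafed : X.toPresheafedSpace ⟶ quotPresheafedSpace F where
  base := 𝟙 X.toTopCat
  c := quotIncl F

theorem stalkMap_germ (U : X.Opens) (x : X) (hx : x ∈ U) (a : invariants F U) :
    (quotProjPresheafed F).stalkMap x ((quotPresheaf F).germ U x hx a) =
      X.presheaf.germ U x hx a.1 := by
  exact PresheafedSpace.stalkMap_germ_apply (quotProjPresheafed F) U x hx a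

theorem isUnit_germ (U : X.Opens) (x : X) (hx : x ∈ U) (a : invariants F U)
    (hz : IsUnit (X.presheaf.germ U x hx a.1)) : IsUnit ((quotPresheaf F).germ U x hx a) := by
  obtain ⟨V, hxV, i, hu⟩ : ∃ (V : X.Opens) (_ : x ∈ V) (i : V ⟶ U),
      IsUnit (X.presheaf.map i.op a.1) :=
    ⟨X.basicOpen a.1, (X.mem_basicOpen a.1 x hx).mpr hz, homOfLE (X.basicOpen_le a.1),
      X.toRingedSpace.isUnit_res_basicOpen a.1⟩
  obtain ⟨b, hb⟩ := hu.exists_right_inv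
  have hbi : b ∈ invariants F V := by
    intro y hy D hD
    have h0 := invariants_res F i a.2 y hy D hD
    have h1 := congrArg (X.presheaf.germ V y hy) hb
    rw [map_mul, map_one] at h1
    have h2 := congrArg D h1
    rw [D.leibniz, h0, D.map_one_eq_zero, smul_zero, add_zero, smul_eq_mul] at h2
    have h3 : IsUnit (X.presheaf.germ V y hy (X.presheaf.map i.op a.1)) := hu.map _
    exact (h3.mul_right_eq_zero).mp h2
  have h4 : IsUnit ((quotPresheaf F).map i.op a) :=
    IsUnit.of_mul_eq_one (⟨b, hbi⟩ : invariants F V) (Subtype.ext hb)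
  have h5 := h4.map ((quotPresheaf F).germ V x hxV).hom
  have h6 := TopCat.Presheaf.germ_res_apply (quotPresheaf F) i x hxV a
  rw [← h6]
  exact h5

theorem isLocalHom_stalkMap (x : X) : IsLocalHom ((quotProjPresheafed F).stalkMap x).hom := by
  constructor
  intro z hz
  obtain ⟨U, hx, a, rfl⟩ := (quotPresheaf F).exists_germ_eq z
  have h1 := stalkMap_germ F U x hx a
  refine isUnit_germ F U x hx a ?_
  rw [← h1]
  exact hz

/-- The locally ringed space `(|X|, O_X^F)`. -/
def quotLRS : LocallyRingedSpace.{u} where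
  toPresheafedSpace := quotPresheafedSpace F
  IsSheaf := quotPresheaf_isSheaf F
  isLocalRing x := by
    have := isLocalHom_stalkMap F x
    have : IsLocalRing (X.presheaf.stalk x) := X.isLocalRing x
    exact @RingHom.domain_isLocalRing _ _ _ _ this ((quotProjPresheafed F).stalkMap x).hom
      (isLocalHom_stalkMap F x)

def quotProjLRS : X.toLocallyRingedSpace ⟶ quotLRS F where
  toHom := quotProjPresheafed F
  prop := isLocalHom_stalkMap F

section descend
variable {W : Scheme.{u}} (h : X ⟶ W)
  (hh : ∀ (V : W.Opens) (b : Γ(W, V)), h.app V b ∈ invariants F (h ⁻¹ᵁ V))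

def descPresheafed : quotPresheafedSpace F ⟶ W.toPresheafedSpace where
  base := h.base
  c :=
    { app := fun V => CommRingCat.ofHom ((h.app V.unop).hom.codRestrict _ (hh V.unop))
      naturality := by
        intro V V' i
        ext b
        exact Subtype.ext congr($(h.c.naturality i) b) }

theorem descPresheafed_fac :
    quotProjPresheafed F ≫ descPresheafed F h hh = h.toLRSHom.toHom := rfl

def descLRS : quotLRS F ⟶ W.toLocallyRingedSpace where
  toHom := descPresheafed F h hh
  prop x := by
    have h1 : IsLocalHom (h.toLRSHom.toHom.stalkMap x).hom := h.toLRSHom.prop x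
    have h2 : h.toLRSHom.toHom.stalkMap x =
      (descPresheafed F h hh).stalkMap x ≫ (quotProjPresheafed F).stalkMap x :=
      PresheafedSpace.stalkMap.comp (quotProjPresheafed F) (descPresheafed F h hh) x
    rw [h2] at h1
    exact @isLocalHom_of_comp _ _ _ _ _ _ ((descPresheafed F h hh).stalkMap x).hom
      ((quotProjPresheafed F).stalkMap x).hom h1

theorem descLRS_fac : quotProjLRS F ≫ descLRS F h hh = h.toLRSHom := rfl

end descend

section scheme

theorem germ_injective (U V : X.Opens) (x : X) (hU : x ∈ U) (hV : x ∈ V)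
    (a : invariants F U) (b : invariants F V)
    (h : X.presheaf.germ U x hU a.1 = X.presheaf.germ V x hV b.1) :
    (quotPresheaf F).germ U x hU a = (quotPresheaf F).germ V x hV b := by
  obtain ⟨W, hxW, i, j, hij⟩ := X.presheaf.germ_eq x hU hV a.1 b.1 h
  exact (quotPresheaf F).germ_ext W hxW i j (Subtype.ext hij)

theorem stalkMap_injective (x : X) : Function.Injective ((quotProjPresheafed F).stalkMap x).hom := by
  intro z z' h
  obtain ⟨U, hU, a, rfl⟩ := (quotPresheaf F).exists_germ_eq z
  obtain ⟨V, hV, b, rfl⟩ := (quotPresheaf F).exists_germ_eq z'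
  exact germ_injective F U V x hU hV a b
    ((stalkMap_germ F U x hU a).symm.trans (h.trans (stalkMap_germ F V x hV b)))

theorem natCast_eq_zero {p : ℕ} (hp : (p : Γ(X, ⊤)) = 0) (U : X.Opens) : (p : Γ(X, U)) = 0 := by
  have h := congrArg (X.presheaf.map (homOfLE (le_top : U ≤ ⊤)).op) hp
  rw [map_natCast, map_zero] at h
  exact h

theorem derivation_pow {p : ℕ} (hp : (p : Γ(X, ⊤)) = 0) (x : X) (D : TangentStalk f x)
    (a : X.presheaf.stalk x) : D (a ^ p) = 0 := by
  have h : (p : X.presheaf.stalk x) = 0 := by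
    have h := congrArg (X.presheaf.germ ⊤ x trivial) hp
    rwa [map_natCast, map_zero] at h
  rw [D.leibniz_pow, nsmul_eq_mul, h, zero_mul]

theorem pow_mem {p : ℕ} (hp : (p : Γ(X, ⊤)) = 0) (U : X.Opens) (a : Γ(X, U)) :
    a ^ p ∈ invariants F U := by
  intro x hx D _
  rw [map_pow]
  exact derivation_pow hp x D _

theorem exists_num {p : ℕ} (hp0 : p ≠ 0) (hp : (p : Γ(X, ⊤)) = 0) (hF : IsCoherent F) (x : X) :
    ∃ U : X.Opens, IsAffineOpen U ∧ x ∈ U ∧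
    ∀ (V : X.Opens), V ≤ U → ∀ w ∈ invariants F V, ∀ (y : X) (hyV : y ∈ V) (hy : y ∈ U),
      ∃ a ∈ invariants F U, ∃ b ∈ invariants F U,
      IsUnit (X.presheaf.germ U y hy a) ∧
      X.presheaf.germ V y hyV w * X.presheaf.germ U y hy a = X.presheaf.germ U y hy b := by
  obtain ⟨U₀, hxU₀, n, D, hD, hspan⟩ := hF x
  obtain ⟨_, ⟨U, hU, rfl⟩, hxU, hUU₀⟩ :=
    X.isBasis_affineOpens.exists_subset_of_mem_open hxU₀ U₀.isOpen
  replace hU : IsAffineOpen U := hU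
  replace hUU₀ : U ≤ U₀ := hUU₀
  refine ⟨U, hU, hxU, fun V hVU w hw y hyV hy => ?_⟩
  obtain ⟨a, haV, hya⟩ := hU.exists_basicOpen_le ⟨y, hyV⟩ hy
  replace hya : y ∈ X.basicOpen a := hya
  have hloc := hU.isLocalization_basicOpen a
  obtain ⟨⟨c, ⟨_, m, rfl⟩⟩, hc⟩ :=
    IsLocalization.surj (Submonoid.powers a) (X.presheaf.map (homOfLE haV).op w)
  have hc : X.presheaf.map (homOfLE haV).op w *
      X.presheaf.map (homOfLE (X.basicOpen_le a)).op (a ^ m) =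
      X.presheaf.map (homOfLE (X.basicOpen_le a)).op c := hc
  have hcy : ∀ (z : X) (hz : z ∈ X.basicOpen a),
      X.presheaf.germ V z (haV hz) w * X.presheaf.germ U z (X.basicOpen_le a hz) a ^ m =
        X.presheaf.germ U z (X.basicOpen_le a hz) c := by
    intro z hz
    have h := congrArg (X.presheaf.germ _ z hz) hc
    rw [map_mul, TopCat.Presheaf.germ_res_apply, TopCat.Presheaf.germ_res_apply,
      TopCat.Presheaf.germ_res_apply, map_pow] at h
    exact h
  obtain ⟨q, rfl⟩ : ∃ q, p = q + 1 := Nat.exists_eq_succ_of_ne_zero hp0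
  have hk : ∀ i, ∃ k : ℕ, ∀ (z : X) (hz : z ∈ U),
      X.presheaf.germ U z hz (a ^ k) * D i z (X.presheaf.germ U z hz (c * a ^ (q * m))) = 0 := by
    intro i
    obtain ⟨e, he⟩ := hD i U hUU₀ (c * a ^ (q * m))
    have h0 : X.presheaf.map (homOfLE (X.basicOpen_le a)).op e = 0 := by
      apply TopCat.Presheaf.section_ext X.sheaf
      intro z hz
      have h1 := he z (X.basicOpen_le a hz)
      have h2 : X.presheaf.germ _ z hz (X.presheaf.map (homOfLE (X.basicOpen_le a)).op e) =
        X.presheaf.germ U z (X.basicOpen_le a hz) e := TopCat.Presheaf.germ_res_apply _ _ _ _ _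
      refine h2.trans (h1.trans ?_)
      have h3 : X.presheaf.germ U z (X.basicOpen_le a hz) (c * a ^ (q * m)) =
          X.presheaf.germ V z (haV hz) w *
            (X.presheaf.germ U z (X.basicOpen_le a hz) a ^ m) ^ (q + 1) := by
        rw [map_mul, ← hcy z hz, map_pow]
        ring
      have h4 : D i z (X.presheaf.germ V z (haV hz) w) = 0 := by
        refine hw z (haV hz) _ ?_
        rw [hspan z (hUU₀ (X.basicOpen_le a hz))]
        exact Submodule.subset_span ⟨i, rfl⟩
      rw [h3, (D i z).leibniz, h4, derivation_pow hp, smul_zero, smul_zero, add_zero]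
      exact (map_zero (X.presheaf.germ _ z hz).hom).symm
    obtain ⟨⟨_, k, rfl⟩, hk⟩ := IsLocalization.exists_of_eq (M := Submonoid.powers a)
      (S := Γ(X, X.basicOpen a)) (x := e) (y := 0) (by
        rw [map_zero]; exact h0)
    refine ⟨k, fun z hz => ?_⟩
    rw [← he z hz, ← map_mul]
    replace hk : a ^ k * e = a ^ k * 0 := hk
    rw [hk, mul_zero, map_zero]
  choose k hk using hk
  refine ⟨(a ^ (m + ∑ i, k i)) ^ (q + 1), pow_mem F hp U _,
    (a ^ ∑ i, k i) ^ (q + 1) * (c * a ^ (q * m)), ?_, ?_, ?_⟩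
  · intro z hz E hE
    rw [hspan z (hUU₀ hz)] at hE
    induction hE using Submodule.span_induction with
    | mem E hE =>
      obtain ⟨i, rfl⟩ := hE
      obtain ⟨r, hr⟩ : a ^ k i ∣ (a ^ ∑ i, k i) ^ (q + 1) := by
        rw [← pow_mul]
        exact pow_dvd_pow _ ((Finset.single_le_sum (fun _ _ => Nat.zero_le _)
          (Finset.mem_univ i)).trans (Nat.le_mul_of_pos_right _ (Nat.succ_pos q)))
      rw [map_mul, (D i z).leibniz, map_pow _ _ (q + 1), derivation_pow hp, smul_zero, add_zero,
        ← map_pow, hr, map_mul, smul_eq_mul, mul_right_comm, hk i z hz, zero_mul]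
    | zero => rfl
    | add E E' _ _ h h' => rw [Derivation.add_apply, h, h', add_zero]
    | smul r E _ h => rw [Derivation.smul_apply, h, smul_zero]
  · rw [map_pow, map_pow]
    exact (((X.mem_basicOpen a y hy).mp hya).pow _).pow _
  · have h := hcy y hya
    simp only [map_mul, map_pow]
    rw [← h]
    ring

theorem quotLRS_local {p : ℕ} [hpp : Fact p.Prime] (hp : (p : Γ(X, ⊤)) = 0) (hF : IsCoherent F)
    (x : quotLRS F) : ∃ (R : CommRingCat.{u}) (j : Spec.toLocallyRingedSpace.obj (op R) ⟶ quotLRS F),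
      x ∈ Set.range j.base ∧ LocallyRingedSpace.IsOpenImmersion j := by
  have hp0 := hpp.out.ne_zero
  obtain ⟨U, hU⟩ := exists_num F hp0 hp hF x
  have hxU : x ∈ U := hU.2.1
  have htop : U.isOpenEmbedding.functor.obj ⊤ = U := Opens.isOpenEmbedding_obj_top U
  rw [← htop] at hU
  obtain ⟨haff, -, hnum⟩ := hU
  let Y := (quotLRS F).restrict (U := TopCat.of U) (f := Opens.inclusion' U) U.isOpenEmbedding
  have hmem : ∀ y : U, y.1 ∈ U.isOpenEmbedding.functor.obj ⊤ := fun y => by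
    rw [htop]; exact y.2
  have hθ : ∀ y : U, ∃ θ : Y.presheaf.stalk y →+* X.presheaf.stalk y.1,
      Function.Injective θ ∧ (∀ z, IsUnit (θ z) → IsUnit z) ∧
      ∀ (V : Opens U) (hy : y ∈ V) (hy' : y.1 ∈ U.isOpenEmbedding.functor.obj V)
        (a : invariants F (U.isOpenEmbedding.functor.obj V)),
        θ (Y.presheaf.germ V y hy a) = X.presheaf.germ _ y.1 hy' a.1 := by
    intro y
    let e := ((quotLRS F).restrictStalkIso U.isOpenEmbedding y).commRingCatIsoToRingEquiv
    refine ⟨((quotProjPresheafed F).stalkMap y.1).hom.comp e.toRingHom, ?_, ?_, ?_⟩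
    · exact (stalkMap_injective F y.1).comp e.injective
    · intro z hz
      have h := (isLocalHom_stalkMap F y.1).map_nonunit (e z) hz
      exact (MulEquiv.isUnit_map e).mp h
    · intro V hy hy' a
      have h := LocallyRingedSpace.restrictStalkIso_hom_eq_germ_apply (quotLRS F) U.isOpenEmbedding
        V y hy a
      exact (congrArg ((quotProjPresheafed F).stalkMap y.1).hom h).trans
        (stalkMap_germ F _ y.1 hy' a)
  choose θ hθi hθu hθg using hθ
  have hΓ : ∀ (y : U) (a : invariants F (U.isOpenEmbedding.functor.obj ⊤)),
      θ y (Y.presheaf.Γgerm y a) = X.presheaf.germ _ y.1 (hmem y) a.1 :=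
    fun y a => hθg y ⊤ trivial (hmem y) a
  have hunit : ∀ (y : U) (a : invariants F (U.isOpenEmbedding.functor.obj ⊤)),
      IsUnit (Y.presheaf.Γgerm y a) ↔ IsUnit (X.presheaf.germ _ y.1 (hmem y) a.1) := by
    intro y a
    rw [← hΓ]
    exact ⟨fun h => h.map (θ y), hθu y _⟩
  have hiso : IsIso Y.toΓSpec := by
    have : T0Space Y := inferInstanceAs (T0Space U)
    refine isIso_toΓSpec Y ?_ ?_ ?_ ?_
    · intro y z
      obtain ⟨V, hy, w, rfl⟩ := Y.presheaf.exists_germ_eq z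
      have hy' : y.1 ∈ U.isOpenEmbedding.functor.obj V := ⟨y, hy, rfl⟩
      obtain ⟨a, ha, b, hb, hu, he⟩ := hnum _
        (U.isOpenEmbedding.functor.map (homOfLE (le_top : V ≤ ⊤))).le w.1 w.2 y.1 hy' (hmem y)
      refine ⟨(⟨a, ha⟩ : invariants F _), (⟨b, hb⟩ : invariants F _), (hunit y _).mpr hu, ?_⟩
      apply hθi y
      rw [map_mul]
      refine (congrArg₂ (· * ·) (hθg y V hy hy' w) (hΓ y ⟨a, ha⟩)).trans (he.trans ?_)
      exact (hΓ y ⟨b, hb⟩).symm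
    · intro y b hb
      have hb' : X.presheaf.germ _ y.1 (hmem y) b.1 = 0 :=
        (hΓ y b).symm.trans ((congrArg (θ y) hb).trans (map_zero _))
      obtain ⟨a, ha, hab⟩ := exists_mul_eq_zero haff y.1 (hmem y) b.1 hb'
      refine ⟨(⟨a ^ p, pow_mem F hp _ a⟩ : invariants F _), (hunit y _).mpr ?_, Subtype.ext ?_⟩
      · change IsUnit (X.presheaf.germ _ y.1 (hmem y) (a ^ p))
        rw [map_pow]
        exact ha.pow p
      · change a ^ p * (show Γ(X, U.isOpenEmbedding.functor.obj ⊤) from b.1) = 0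
        obtain ⟨r, hr⟩ : a ∣ a ^ p := dvd_pow_self a hp0
        rw [hr, mul_right_comm, hab, zero_mul]
    · intro q
      obtain ⟨q', hq'⟩ := exists_prime (invariants F (U.isOpenEmbedding.functor.obj ⊤)) p
        (natCast_eq_zero hp _) (fun a => pow_mem F hp _ a) q
      obtain ⟨x, hx, h⟩ := exists_point haff q'
      refine ⟨(⟨x, by rwa [htop] at hx⟩ : U), fun b => ?_⟩
      refine (not_iff_not.mpr (hq' b)).trans ((h _).trans ?_)
      exact (hunit ⟨x, _⟩ b).symm
    · intro y V hyV
      have hyV' : y.1 ∈ U.isOpenEmbedding.functor.obj V := ⟨y, hyV, rfl⟩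
      obtain ⟨a, haV, hya⟩ := haff.exists_basicOpen_le ⟨y.1, hyV'⟩ (hmem y)
      have hya : y.1 ∈ X.basicOpen a := hya
      refine ⟨(⟨a ^ p, pow_mem F hp _ a⟩ : invariants F _), (hunit y _).mpr ?_, fun z hz => ?_⟩
      · change IsUnit (X.presheaf.germ _ y.1 (hmem y) (a ^ p))
        rw [map_pow]
        exact ((X.mem_basicOpen a y.1 (hmem y)).mp hya).pow p
      · have h1 : IsUnit (X.presheaf.germ _ z.1 (hmem z) (a ^ p)) := (hunit z _).mp hz
        rw [map_pow, isUnit_pow_iff hp0, ← X.mem_basicOpen a z.1 (hmem z)] at h1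
        obtain ⟨z', hz', hzz⟩ := haV h1
        have : z' = z := Subtype.ext hzz
        rwa [← this]
  exact exists_chart (quotLRS F) (g := Opens.inclusion' U) U.isOpenEmbedding hiso ⟨x, hxU⟩

/-- The quotient `X / F`: the locally ringed space `(|X|, O_X^F)`, which is a scheme. -/
def quotient {p : ℕ} [Fact p.Prime] (hp : (p : Γ(X, ⊤)) = 0) (hF : IsCoherent F) : Scheme.{u} :=
  LocallyRingedSpace.IsOpenImmersion.scheme (quotLRS F) (quotLRS_local F hp hF)

/-- The quotient morphism `q : X ⟶ X / F`: the identity on points, the inclusion of `O_X^F` in `O_X`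
on functions. -/
def quotientProj {p : ℕ} [Fact p.Prime] (hp : (p : Γ(X, ⊤)) = 0) (hF : IsCoherent F) :
    X ⟶ quotient F hp hF :=
  ⟨quotProjLRS F⟩

/-- A morphism `h : X ⟶ W` whose pulled back functions are killed by `F` factors through `X / F`. -/
def quotientDesc {p : ℕ} [Fact p.Prime] (hp : (p : Γ(X, ⊤)) = 0) (hF : IsCoherent F)
    {W : Scheme.{u}} (h : X ⟶ W)
    (hh : ∀ (V : W.Opens) (b : Γ(W, V)), h.app V b ∈ invariants F (h ⁻¹ᵁ V)) :
    quotient F hp hF ⟶ W :=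
  ⟨descLRS F h hh⟩

theorem quotientProj_desc {p : ℕ} [Fact p.Prime] (hp : (p : Γ(X, ⊤)) = 0) (hF : IsCoherent F)
    {W : Scheme.{u}} (h : X ⟶ W)
    (hh : ∀ (V : W.Opens) (b : Γ(W, V)), h.app V b ∈ invariants F (h ⁻¹ᵁ V)) :
    quotientProj F hp hF ≫ quotientDesc F hp hF h hh = h := rfl

instance quotientProj_epi {p : ℕ} [Fact p.Prime] (hp : (p : Γ(X, ⊤)) = 0) (hF : IsCoherent F) :
    Epi (quotientProj F hp hF) := by
  apply CategoryTheory.Functor.epi_of_epi_map (Scheme.forgetToLocallyRingedSpace)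
  apply CategoryTheory.Functor.epi_of_epi_map (LocallyRingedSpace.forgetToSheafedSpace)
  apply SheafedSpace.epi_of_base_surjective_of_stalk_mono _ Function.surjective_id
  intro x
  apply ConcreteCategory.mono_of_injective
  exact stalkMap_injective F x

end scheme
end quot

theorem natCast_eq_zero_of_hom {X Y : Scheme.{u}} (h : X ⟶ Y) {p : ℕ} (hp : (p : Γ(Y, ⊤)) = 0) :
    (p : Γ(X, ⊤)) = 0 := by
  have := congrArg h.appTop hp
  rwa [map_natCast, map_zero] at this

theorem natCast_eq_zero_of_charP {S : Scheme.{u}} {k : Type u} [Field k] {p : ℕ} [CharP k p]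
    (σ : S ⟶ Spec (.of k)) : (p : Γ(S, ⊤)) = 0 := by
  refine natCast_eq_zero_of_hom σ ?_
  have := congrArg (Scheme.ΓSpecIso (.of k)).inv (CharP.cast_eq_zero k p)
  rwa [map_natCast, map_zero] at this

theorem app_mem_invariants {X S : Scheme.{u}} {f : X ⟶ S} (F : StalkFamily f) (V : S.Opens)
    (b : Γ(S, V)) : f.app V b ∈ invariants F (f ⁻¹ᵁ V) := by
  intro x hx D _
  have h : X.presheaf.germ (f ⁻¹ᵁ V) x hx (f.app V b) =
    algebraMap (S.presheaf.stalk (f x)) (X.presheaf.stalk x) (S.presheaf.germ V (f x) hx b) :=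
    (Scheme.Hom.germ_stalkMap_apply f V x hx b).symm
  rw [h, D.map_algebraMap]

/-- The morphism `g : X / F ⟶ S` through which `f : X ⟶ S` factors. -/
def quotientMap {X S : Scheme.{u}} {f : X ⟶ S} (F : StalkFamily f) {p : ℕ} [Fact p.Prime]
    (hp : (p : Γ(X, ⊤)) = 0) (hF : IsCoherent F) : quotient F hp hF ⟶ S :=
  quotientDesc F hp hF f (app_mem_invariants F)

section family
variable {X S : Scheme.{u}} {f : X ⟶ S}

/-- The derivation `D'` of the fiber `X_s` at `y` is the restriction of the derivation `D` of `X`. -/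
def IsRestriction (s : S) (y : f.fiber s) (D : TangentStalk f (f.fiberι s y))
    (D' : TangentStalk (f.fiberToSpecResidueField s) y) : Prop :=
  ∀ a, D' ((f.fiberι s).stalkMap y a) = (f.fiberι s).stalkMap y (D a)

/-- The image `F_s` of `F ⊗ κ(s)` in `T_{X_s/κ(s)}`: it is generated by the restrictions to `X_s` of
the elements of `F`. -/
def StalkFamily.fiber (F : StalkFamily f) (s : S) : StalkFamily (f.fiberToSpecResidueField s) :=
  fun y => Submodule.span _ {D' | ∃ D ∈ F (f.fiberι s y), IsRestriction s y D D'}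

theorem fiber_app_mem (F : StalkFamily f) (s : S) {p : ℕ} [Fact p.Prime]
    (hp : (p : Γ(X, ⊤)) = 0) (hF : IsCoherent F) (V : (quotient F hp hF).Opens)
    (b : Γ(quotient F hp hF, V)) :
    (f.fiberι s ≫ quotientProj F hp hF).app V b ∈
      invariants (F.fiber s) ((f.fiberι s ≫ quotientProj F hp hF) ⁻¹ᵁ V) := by
  intro y hy D hD
  obtain ⟨b', hb'⟩ : ∃ b' : invariants F (quotientProj F hp hF ⁻¹ᵁ V),
    (f.fiberι s ≫ quotientProj F hp hF).app V b = (f.fiberι s).app _ b'.1 := ⟨b, rfl⟩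
  have h : (f.fiber s).presheaf.germ _ y hy ((f.fiberι s ≫ quotientProj F hp hF).app V b) =
      (f.fiberι s).stalkMap y (X.presheaf.germ (quotientProj F hp hF ⁻¹ᵁ V) (f.fiberι s y) hy b'.1) := by
    rw [hb']
    exact (Scheme.Hom.germ_stalkMap_apply (f.fiberι s) _ y hy b'.1).symm
  rw [h]
  induction hD using Submodule.span_induction with
  | mem D hD =>
    obtain ⟨E, hE, hED⟩ := hD
    refine (hED _).trans ?_
    exact (congrArg ((f.fiberι s).stalkMap y).hom (b'.2 (f.fiberι s y) hy E hE)).trans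
      (map_zero _)
  | zero => rfl
  | add E E' _ _ h h' => rw [Derivation.add_apply, h, h', add_zero]
  | smul r E _ h => rw [Derivation.smul_apply, h, smul_zero]

/-- The comparison morphism `φ_s : X_s / F_s ⟶ (X / F)_s`. Its component to `X / F` is induced by
`X_s ⟶ X ⟶ X / F`, and its component to `Spec κ(s)` by `X_s ⟶ Spec κ(s)`. -/
def fiberComparison (F : StalkFamily f) (s : S) {p : ℕ} [Fact p.Prime]
    (hp : (p : Γ(X, ⊤)) = 0) (hF : IsCoherent F) (hFs : IsCoherent (F.fiber s)) :
    quotient (F.fiber s) (natCast_eq_zero_of_hom (f.fiberι s) hp) hFs ⟶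
      (quotientMap F hp hF).fiber s :=
  Limits.pullback.lift
    (quotientDesc (F.fiber s) (natCast_eq_zero_of_hom (f.fiberι s) hp) hFs
      (f.fiberι s ≫ quotientProj F hp hF) (fiber_app_mem F s hp hF))
    (quotientMap (F.fiber s) (natCast_eq_zero_of_hom (f.fiberι s) hp) hFs)
    (by
      rw [← cancel_epi (quotientProj (F.fiber s) (natCast_eq_zero_of_hom (f.fiberι s) hp) hFs)]
      exact f.fiber_fac s)

end family

/-- An `F`-finite scheme of characteristic `p`: the absolute Frobenius is a finite morphism, that
is, the ring of sections over each affine open is a finite module over its subring of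
`p`-th powers. -/
def IsFFinite (p : ℕ) (S : Scheme.{u}) : Prop :=
  ∀ W : S.Opens, IsAffineOpen W → ∃ t : Finset Γ(S, W), ∀ a : Γ(S, W),
    ∃ c : Γ(S, W) → Γ(S, W), a = ∑ b ∈ t, c b ^ p * b

/-- A normal scheme: all the local rings are integrally closed domains. -/
def IsNormalScheme (X : Scheme.{u}) : Prop :=
  ∀ x : X, IsDomain (X.presheaf.stalk x) ∧ IsIntegrallyClosed (X.presheaf.stalk x)

/-- A regular scheme: all the local rings are (Noetherian) regular local rings. -/
def IsRegularScheme (S : Scheme.{u}) : Prop :=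
  ∀ s : S, IsRegularLocalRing (S.presheaf.stalk s)

/-- A `1`-foliation of rank `r` on a scheme `X` relative to `f : X ⟶ S` (it is used for normal
schemes of finite type over a field): a coherent subsheaf of `T_{X/S}` which is saturated
(the quotient is torsion-free), closed under Lie brackets and under `p`-th powers, and which
has rank `r` at every generic point of `X`. (The local rings of a normal scheme which are fields
are those at the generic points.) -/
structure IsOneFoliation (p r : ℕ) {X S : Scheme.{u}} (f : X ⟶ S) (F : StalkFamily f) : Prop where
  coherent : IsCoherent F
  saturated : ∀ (x : X) (a : X.presheaf.stalk x) (D : TangentStalk f x),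
    a ∈ nonZeroDivisors (X.presheaf.stalk x) → a • D ∈ F x → D ∈ F x
  lie : ∀ (x : X) (D E : TangentStalk f x), D ∈ F x → E ∈ F x → ⁅D, E⁆ ∈ F x
  pow : ∀ (x : X) (D : TangentStalk f x), D ∈ F x →
    ∃ E ∈ F x, ∀ a : X.presheaf.stalk x, E a = (⇑D)^[p] a
  rank : ∀ x : X, IsField (X.presheaf.stalk x) → Module.finrank (X.presheaf.stalk x) (F x) = r

/-- The restriction of `T_{X/S}` to every fiber `X_s` is naturally identified with
`T_{X_s/κ(s)}`: at every point `y` of `X_s`, restricting relative derivations to the fiber gives an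
isomorphism `κ(s) ⊗ T_{X/S, y} ≅ T_{X_s/κ(s), y}`. -/
def TangentCommutesWithFibers {X S : Scheme.{u}} (f : X ⟶ S) : Prop :=
  ∀ (s : S) (y : f.fiber s),
    ∃ e : TensorProduct (S.presheaf.stalk (f (f.fiberι s y)))
        (IsLocalRing.ResidueField (S.presheaf.stalk (f (f.fiberι s y))))
        (TangentStalk f (f.fiberι s y)) ≃+
      TangentStalk (f.fiberToSpecResidueField s) y,
    ∀ D : TangentStalk f (f.fiberι s y),
      IsRestriction s y D (e (TensorProduct.tmul _ 1 D))

/-- A family of `1`-foliations of rank `r` over `S` on `f : X ⟶ S`, in characteristic `p`. -/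
structure IsFamilyOfOneFoliations (p r : ℕ) {X S : Scheme.{u}} (f : X ⟶ S) (F : StalkFamily f) :
    Prop where
  locallyNoetherian : IsLocallyNoetherian S
  fFinite : IsFFinite p S
  flat : Flat f
  locallyOfFiniteType : LocallyOfFiniteType f
  quasiCompact : QuasiCompact f
  coherent : IsCoherent F
  /-- The fibers of `f` are geometrically normal. -/
  normal : geometrically IsNormalScheme f
  /-- `f_* O_X = O_S`. -/
  pushforward : ∀ W : S.Opens, Function.Bijective (f.app W)
  /-- `T_{X/S}` is flat over `S`. -/
  tangent_flat : ∀ x : X, Module.Flat (S.presheaf.stalk (f x)) (TangentStalk f x)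
  tangent_fiber : TangentCommutesWithFibers f
  /-- `T_{X/S} / F` is flat over `S`. -/
  quotient_flat : ∀ x : X, Module.Flat (S.presheaf.stalk (f x)) (TangentStalk f x ⧸ F x)
  fiber : ∀ s : S, IsOneFoliation p r (f.fiberToSpecResidueField s) (F.fiber s)

section formal
variable {X S : Scheme.{u}} {f : X ⟶ S}

/-- The completion of the local ring of `X` at `x`. -/
abbrev CompletedStalk (X : Scheme.{u}) (x : X) : Type u :=
  AdicCompletion (IsLocalRing.maximalIdeal (X.presheaf.stalk x)) (X.presheaf.stalk x)

/-- The `O_{S, f x}`-linear derivations of the completed local ring at `x`. They are continuous: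
by the Leibniz rule, a derivation maps the `(n + 1)`-st power of the maximal ideal into the `n`-th
power. -/
abbrev FormalTangent (f : X ⟶ S) (x : X) : Type u :=
  Derivation (S.presheaf.stalk (f x)) (CompletedStalk X x) (CompletedStalk X x)

/-- The formal completion of `F` at `x`: the module of derivations of the completed local ring
which is generated by the continuous extensions of the elements of `F x`. -/
def formal (F : StalkFamily f) (x : X) : Submodule (CompletedStalk X x) (FormalTangent f x) :=
  Submodule.span _ {E | ∃ D ∈ F x, ∀ a : X.presheaf.stalk x,
    E (algebraMap (X.presheaf.stalk x) (CompletedStalk X x) a) =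
      algebraMap (X.presheaf.stalk x) (CompletedStalk X x) (D a)}

/-- A derivation `E` is multiplicative if its `p`-th iterate is `u E` for a unit `u`. -/
def IsMultiplicative (p : ℕ) {x : X} (E : FormalTangent f x) : Prop :=
  ∃ u : (CompletedStalk X x)ˣ, ∀ a, (⇑E)^[p] a = u * E a

/-- `F` has at worst multiplicative singularities at `x`: the formal completion of `F` at `x` is
the saturation of the span of finitely many multiplicative derivations that commute with each
other. -/
def HasMultiplicativeSingularitiesAt (p : ℕ) (F : StalkFamily f) (x : X) : Prop :=
  ∃ G : Finset (FormalTangent f x),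
    (∀ E ∈ G, IsMultiplicative p E) ∧ (∀ E ∈ G, ∀ E' ∈ G, ⁅E, E'⁆ = 0) ∧
    ∀ E : FormalTangent f x, E ∈ formal F x ↔
      ∃ a ∈ nonZeroDivisors (CompletedStalk X x),
        a • E ∈ Submodule.span (CompletedStalk X x) (G : Set (FormalTangent f x))

end formal

/-- A morphism `φ : Y ⟶ Z` is an isomorphism at `y` if it restricts to an isomorphism over an open
neighbourhood of `φ y`. -/
def IsIsoAt {Y Z : Scheme.{u}} (φ : Y ⟶ Z) (y : Y) : Prop :=
  ∃ V : Z.Opens, φ y ∈ V ∧ IsIso (φ ∣_ V)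

end Foliation

end

open Foliation

/-! Write `R` for the local ring of the base, `A` for that of `X` at `z`, and `B` for the subring of
`A` killed by `F`. The statement reduces to three assertions: `B` is flat over `R`; `JA ∩ B = JB`
for an ideal `J` of `R`; and every element of `A` that `F` kills modulo `JA` is congruent modulo
`JA` to an element of `B`.

If invariants were taken by a linearly reductive group, a Reynolds operator would give all three.
Multiplicative derivations supply such an operator on the completion of `A`: if `E ^ p = u E` with
`u` a unit, then `1 - u⁻¹ E ^ (p - 1)` is an `R`-linear projection onto the kernel of `E`. For
commuting derivations these projections compose to a projection `π` onto the common kernel, which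
preserves congruences modulo stable ideals (`exists_projector`).

The operator `π` need not map `A` to `A`, so its consequences must be descended. All `p`-th powers
of `A` lie in `B`, hence `A` is finite over `B`, and `B` is Noetherian by Artin-Tate. By Artin-Rees,
an element of the completion killed by the frame is congruent, modulo any power of the maximal ideal
of `B`, to an element of `B` (`IsMultiplicativeFrame.exists_algHom`). Each assertion can be phrased
as membership in a `B`-submodule of a finite `B`-module, and such submodules are closed by Krull's
intersection theorem (`mem_of_forall_exists_sub_mem`), so approximate solutions suffice.

With `J` the maximal ideal of `R`, the last two assertions say that the comparison morphism is an
isomorphism on the local ring at the given point (`isIso_stalkMap_fiberComparison`). It is injective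
and locally of finite type over a locally Noetherian scheme, so the inverse on the local ring
spreads out to a neighbourhood (`isIsoAt_of_isIso_stalkMap`). -/

namespace Foliation

/-! ### Projection onto the common kernel of commuting multiplicative derivations. -/

section projector
variable {R C : Type*} [CommRing R] [CommRing C] [Algebra R C]

theorem iterate_mem (E : Derivation R C C) {J : Ideal C} (hJ : ∀ c ∈ J, E c ∈ J) (n : ℕ) {c : C}
    (hc : c ∈ J) : (⇑E)^[n] c ∈ J := by
  induction n with
  | zero => exact hc
  | succ n ih => rw [Function.iterate_succ_apply']; exact hJ _ ih

/-- Apply `E'` to `E ^ p a = u E a` and compare with the same identity at `E' a`. Thus `u` behaves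
as a constant against the image of `E`, although it need not be one; the case `E' = E` is included.
-/
theorem derivation_unit_mul_eq_zero {p : ℕ} {E E' : Derivation R C C} (u : Cˣ)
    (hE : ∀ a, (⇑E)^[p] a = u * E a) (h : ∀ a, E' (E a) = E (E' a)) (a : C) :
    E' (u : C) * E a = 0 := by
  have h1 : E' ((⇑E)^[p] a) = (⇑E)^[p] (E' a) :=
    (Function.Commute.iterate_right (f := ⇑E') (g := ⇑E) h p) a
  rw [hE, hE, E'.leibniz, h, smul_eq_mul, smul_eq_mul] at h1
  linear_combination h1

theorem derivation_unit_inv_mul_eq_zero {p : ℕ} {E E' : Derivation R C C} (u : Cˣ)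
    (hE : ∀ a, (⇑E)^[p] a = u * E a) (h : ∀ a, E' (E a) = E (E' a)) (a : C) :
    E' (↑u⁻¹ : C) * E a = 0 := by
  have h1 := E'.leibniz (u : C) (↑u⁻¹ : C)
  rw [Units.mul_inv, E'.map_one_eq_zero, smul_eq_mul, smul_eq_mul] at h1
  have h2 := derivation_unit_mul_eq_zero u hE h a
  have h3 := u.inv_mul
  linear_combination (-(↑u⁻¹ : C) * E a) * h1 - (↑u⁻¹ : C) * (↑u⁻¹ : C) * h2
    - E' (↑u⁻¹ : C) * E a * h3

/-- The projection `1 - u⁻¹ E ^ (p - 1)` onto the kernel of a multiplicative derivation `E`,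
`E ^ p = u E`. -/
def kerProj (E : Derivation R C C) (u : Cˣ) (p : ℕ) : C →ₗ[R] C :=
  LinearMap.id - LinearMap.mulLeft R (↑u⁻¹ : C) ∘ₗ (E : C →ₗ[R] C) ^ (p - 1)

theorem kerProj_apply (E : Derivation R C C) (u : Cˣ) (p : ℕ) (c : C) :
    kerProj E u p c = c - ↑u⁻¹ * (⇑E)^[p - 1] c := by
  simp [kerProj, Module.End.pow_apply]

/-- The Leibniz term `E (u⁻¹) * E ^ (p - 1) c` vanishes because `p - 1 ≥ 1` puts `E ^ (p - 1) c` in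
the image of `E`. What is left is `E c - u⁻¹ E ^ p c = 0`. -/
theorem apply_kerProj {p : ℕ} (hp : 2 ≤ p) {E : Derivation R C C} (u : Cˣ)
    (hE : ∀ a, (⇑E)^[p] a = u * E a) (c : C) : E (kerProj E u p c) = 0 := by
  obtain ⟨q, rfl⟩ : ∃ q, p = q + 2 := ⟨p - 2, by omega⟩
  have h := derivation_unit_inv_mul_eq_zero u hE (fun _ => rfl) ((⇑E)^[q] c)
  have h1 := hE c
  rw [Function.iterate_succ_apply'] at h1
  rw [kerProj_apply, map_sub, E.leibniz, smul_eq_mul, smul_eq_mul, Nat.add_sub_assoc (by norm_num),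
    h1]
  rw [← Function.iterate_succ_apply' E] at h
  have h3 := u.inv_mul
  change E c - (↑u⁻¹ * (↑u * E c) + (⇑E)^[q + 1] c * E ↑u⁻¹) = 0
  linear_combination - h - E c * h3

theorem commute_kerProj {p : ℕ} (hp : 2 ≤ p) {E E' : Derivation R C C} (u : Cˣ)
    (hE : ∀ a, (⇑E)^[p] a = u * E a) (h : ∀ a, E' (E a) = E (E' a)) (c : C) :
    E' (kerProj E u p c) = kerProj E u p (E' c) := by
  obtain ⟨q, rfl⟩ : ∃ q, p = q + 2 := ⟨p - 2, by omega⟩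
  have h1 := derivation_unit_inv_mul_eq_zero u hE h ((⇑E)^[q] c)
  rw [← Function.iterate_succ_apply' E] at h1
  have h2 : E' ((⇑E)^[q + 1] c) = (⇑E)^[q + 1] (E' c) :=
    (Function.Commute.iterate_right (f := ⇑E') (g := ⇑E) h (q + 1)) c
  rw [kerProj_apply, kerProj_apply, map_sub, E'.leibniz, smul_eq_mul, smul_eq_mul,
    Nat.add_sub_assoc (by norm_num)]
  change E' c - (↑u⁻¹ * E' ((⇑E)^[q + 1] c) + (⇑E)^[q + 1] c * E' ↑u⁻¹) =
    E' c - ↑u⁻¹ * (⇑E)^[q + 1] (E' c)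
  rw [h2]
  linear_combination - h1

/-- Finitely many commuting multiplicative derivations have a linear projection onto their
common kernel. It is compatible with the quotients by invariant ideals. -/
theorem exists_projector {p : ℕ} (hp : 2 ≤ p) (G : Finset (Derivation R C C))
    (hG : ∀ E ∈ G, ∃ u : Cˣ, ∀ a, (⇑E)^[p] a = u * E a)
    (hcomm : ∀ E ∈ G, ∀ E' ∈ G, ⁅E, E'⁆ = 0) :
    ∃ π : C →ₗ[R] C, (∀ c, ∀ E ∈ G, E (π c) = 0) ∧
      ∀ J : Ideal C, (∀ E ∈ G, ∀ c ∈ J, E c ∈ J) → ∀ c, (∀ E ∈ G, E c ∈ J) → π c - c ∈ J := by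
  classical
  induction G using Finset.induction_on with
  | empty => exact ⟨LinearMap.id, by simp, by simp⟩
  | insert E G _ ih =>
    obtain ⟨π, h1, h2⟩ := ih (fun E' h => hG E' (Finset.mem_insert_of_mem h))
      (fun E' h E'' h' => hcomm E' (Finset.mem_insert_of_mem h) E'' (Finset.mem_insert_of_mem h'))
    obtain ⟨u, hu⟩ := hG E (Finset.mem_insert_self _ _)
    -- The outer projection kills `E` and commutes with the other derivations, so it keeps the
    -- kernel already reached by `π`.
    refine ⟨kerProj E u p ∘ₗ π, fun c E' hE' => ?_, fun J hJ c hc => ?_⟩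
    · obtain rfl | hE'G := Finset.mem_insert.mp hE'
      · exact apply_kerProj hp u hu _
      · rw [LinearMap.comp_apply, commute_kerProj hp u hu, h1 c E' hE'G, map_zero]
        intro a
        have h := congr($(hcomm E' hE' E (Finset.mem_insert_self _ _)) a)
        rw [Derivation.commutator_apply, Derivation.zero_apply, sub_eq_zero] at h
        exact h
    · have h3 := h2 J (fun E' h => hJ E' (Finset.mem_insert_of_mem h)) c
        (fun E' h => hc E' (Finset.mem_insert_of_mem h))
      obtain ⟨q, rfl⟩ : ∃ q, p = q + 2 := ⟨p - 2, by omega⟩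
      have hE := hJ E (Finset.mem_insert_self _ _)
      -- At least one application of `E` occurs; it brings `π c` into `J`, since `π c` and `c` agree
      -- modulo the stable ideal `J`.
      have h4 : (⇑E)^[q + 1] (π c) ∈ J := by
        rw [Function.iterate_succ_apply]
        refine iterate_mem E hE q ?_
        have : E (π c) = E (π c - c) + E c := by rw [map_sub]; ring
        rw [this]
        exact J.add_mem (hE _ h3) (hc E (Finset.mem_insert_self _ _))
      rw [LinearMap.comp_apply, kerProj_apply, sub_right_comm]
      exact J.sub_mem h3 (J.mul_mem_left _ h4)

end projector

/-! ### Extension of derivations to the adic completion. -/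

section completion
variable {R A : Type*} [CommRing R] [CommRing A] [Algebra R A]

/-- The Leibniz rule differentiates one factor at a time, so one power is lost. This is the origin
of the shift between levels `n + 1` and `n` below. -/
theorem derivation_mem_pow (D : Derivation R A A) (I : Ideal A) (n : ℕ) {a : A}
    (ha : a ∈ I ^ (n + 1)) : D a ∈ I ^ n := by
  induction n generalizing a with
  | zero => simp
  | succ n ih =>
    rw [pow_succ] at ha
    induction ha using Submodule.mul_induction_on' with
    | mem_mul_mem a ha b hb =>
      rw [D.leibniz, smul_eq_mul, smul_eq_mul]
      refine Ideal.add_mem _ (Ideal.mul_mem_right _ _ ha) ?_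
      rw [pow_succ']
      exact Ideal.mul_mem_mul hb (ih ha)
    | add a _ b _ ha hb => rw [map_add]; exact Ideal.add_mem _ ha hb

variable (I : Ideal A)

theorem exists_evalₐ_eq (c : AdicCompletion I A) (n : ℕ) :
    ∃ a, AdicCompletion.evalₐ I n c = Ideal.Quotient.mk (I ^ n) a := by
  obtain ⟨a, ha⟩ := Ideal.Quotient.mk_surjective (AdicCompletion.evalₐ I n c)
  exact ⟨a, ha.symm⟩

theorem evalₐ_of_le {c : AdicCompletion I A} {m n : ℕ} (h : m ≤ n) {a : A}
    (ha : AdicCompletion.evalₐ I n c = Ideal.Quotient.mk (I ^ n) a) :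
    AdicCompletion.evalₐ I m c = Ideal.Quotient.mk (I ^ m) a := by
  obtain ⟨c, rfl⟩ := AdicCompletion.mk_surjective I A c
  rw [AdicCompletion.evalₐ_mk] at ha ⊢
  rw [← AdicCompletion.Ideal.mk_eq_mk I h, Ideal.Quotient.eq]
  exact Ideal.pow_le_pow_right h (Ideal.Quotient.eq.mp ha)

/-- The value at `c` is the limit of `D` on lifts of `c`. The property is asserted for every lift at
level `n + 1`, not for a chosen one, so that additivity, linearity and the Leibniz rule can be
checked on convenient lifts. -/
theorem exists_extendFun (D : Derivation R A A) (c : AdicCompletion I A) :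
    ∃ d : AdicCompletion I A, ∀ n a,
      AdicCompletion.evalₐ I (n + 1) c = Ideal.Quotient.mk (I ^ (n + 1)) a →
      AdicCompletion.evalₐ I n d = Ideal.Quotient.mk (I ^ n) (D a) := by
  choose a ha using exists_evalₐ_eq I c
  have hD : ∀ n b, AdicCompletion.evalₐ I (n + 1) c = Ideal.Quotient.mk (I ^ (n + 1)) b →
      D (a (n + 1)) - D b ∈ I ^ n := by
    intro n b hb
    rw [ha, Ideal.Quotient.eq] at hb
    rw [← map_sub]
    exact derivation_mem_pow D I n hb
  have hs : ∀ n, D (a (n + 1)) ≡ D (a (n + 1 + 1)) [SMOD (I ^ n • ⊤ : Submodule A A)] := by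
    intro n
    rw [SModEq.sub_mem, smul_eq_mul, Ideal.mul_top]
    exact hD n _ (evalₐ_of_le I (Nat.le_succ _) (ha (n + 1 + 1)))
  refine ⟨AdicCompletion.mk I A (AdicCompletion.AdicCauchySequence.mk I A
    (fun n => D (a (n + 1))) hs), fun n b hb => ?_⟩
  rw [AdicCompletion.evalₐ_mk, Ideal.Quotient.eq]
  exact hD n b hb

/-- The continuous extension of a derivation to the completion. -/
theorem exists_extend (D : Derivation R A A) :
    ∃ D' : Derivation R (AdicCompletion I A) (AdicCompletion I A), ∀ c n a,
      AdicCompletion.evalₐ I (n + 1) c = Ideal.Quotient.mk (I ^ (n + 1)) a →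
      AdicCompletion.evalₐ I n (D' c) = Ideal.Quotient.mk (I ^ n) (D a) := by
  choose d hd using exists_extendFun I D
  refine ⟨Derivation.mk' { toFun := d, map_add' := ?_, map_smul' := ?_ } ?_, hd⟩
  · intro x y
    refine AdicCompletion.ext_evalₐ fun n => ?_
    obtain ⟨a, ha⟩ := exists_evalₐ_eq I x (n + 1)
    obtain ⟨b, hb⟩ := exists_evalₐ_eq I y (n + 1)
    rw [map_add, hd x n a ha, hd y n b hb, hd (x + y) n (a + b) (by rw [map_add, map_add, ha, hb]),
      map_add, map_add]
  · intro r x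
    refine AdicCompletion.ext_evalₐ fun n => ?_
    obtain ⟨a, ha⟩ := exists_evalₐ_eq I x (n + 1)
    have hr : ∀ n, AdicCompletion.evalₐ I n (algebraMap R (AdicCompletion I A) r) =
        Ideal.Quotient.mk (I ^ n) (algebraMap R A r) := fun n => AdicCompletion.evalₐ_of I n _
    rw [RingHom.id_apply, Algebra.smul_def, Algebra.smul_def, map_mul, hr, hd x n a ha,
      hd (algebraMap R _ r * x) n (algebraMap R A r * a) (by rw [map_mul, map_mul, hr, ha]),
      D.leibniz, D.map_algebraMap, smul_zero, add_zero, smul_eq_mul, map_mul]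
  · intro x y
    refine AdicCompletion.ext_evalₐ fun n => ?_
    obtain ⟨a, ha⟩ := exists_evalₐ_eq I x (n + 1)
    obtain ⟨b, hb⟩ := exists_evalₐ_eq I y (n + 1)
    change AdicCompletion.evalₐ I n (d (x * y)) = AdicCompletion.evalₐ I n (x * d y + y * d x)
    rw [hd (x * y) n (a * b) (by rw [map_mul, map_mul, ha, hb]), map_add,
      map_mul (AdicCompletion.evalₐ I n), map_mul (AdicCompletion.evalₐ I n),
      hd x n a ha, hd y n b hb, evalₐ_of_le I (Nat.le_succ n) ha, evalₐ_of_le I (Nat.le_succ n) hb,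
      D.leibniz, smul_eq_mul, smul_eq_mul, map_add, map_mul, map_mul]

theorem extend_algebraMap {D : Derivation R A A}
    {D' : Derivation R (AdicCompletion I A) (AdicCompletion I A)}
    (h : ∀ c n a, AdicCompletion.evalₐ I (n + 1) c = Ideal.Quotient.mk (I ^ (n + 1)) a →
      AdicCompletion.evalₐ I n (D' c) = Ideal.Quotient.mk (I ^ n) (D a)) (a : A) :
    D' (algebraMap A (AdicCompletion I A) a) = algebraMap A (AdicCompletion I A) (D a) :=
  AdicCompletion.ext_evalₐ fun n => (h _ n a (AdicCompletion.evalₐ_of I _ a)).trans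
    (AdicCompletion.evalₐ_of I n (D a)).symm

end completion

/-! ### Krull intersection, Artin-Rees and comparison of adic topologies. -/

open IsLocalRing

/-- Krull's intersection theorem for `P ⧸ N`: submodules of finite modules are closed. -/
theorem mem_of_forall_exists_sub_mem {B P : Type*} [CommRing B] [IsLocalRing B]
    [IsNoetherianRing B] [AddCommGroup P] [Module B P] [Module.Finite B P] (N : Submodule B P)
    {x : P} (h : ∀ k : ℕ, ∃ y ∈ N, x - y ∈ (maximalIdeal B ^ k • ⊤ : Submodule B P)) : x ∈ N := by
  have h1 := Ideal.iInf_pow_smul_eq_bot_of_isLocalRing (M := P ⧸ N) (maximalIdeal B)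
    (maximalIdeal.isMaximal B).ne_top
  rw [← Submodule.Quotient.mk_eq_zero N, ← Submodule.mem_bot B, ← h1, Submodule.mem_iInf]
  intro k
  obtain ⟨y, hy, hxy⟩ := h k
  have h2 := Submodule.mem_map_of_mem (f := N.mkQ) hxy
  rw [Submodule.map_smul'', map_sub, Submodule.mkQ_apply, Submodule.mkQ_apply,
    (Submodule.Quotient.mk_eq_zero N).mpr hy, sub_zero] at h2
  exact Submodule.smul_mono le_rfl le_top h2

/-- Artin-Rees for the range of `Φ`. An element with small image differs from an element of the
kernel by something small. -/
theorem exists_mem_smul_top_of_map_mem {B P Q : Type*} [CommRing B]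
    [IsNoetherianRing B] [AddCommGroup P] [Module B P] [AddCommGroup Q] [Module B Q]
    [Module.Finite B Q] (I : Ideal B) (Φ : P →ₗ[B] Q) (k : ℕ) :
    ∃ j : ℕ, ∀ a, Φ a ∈ (I ^ j • ⊤ : Submodule B Q) →
      ∃ a' ∈ (I ^ k • ⊤ : Submodule B P), Φ a' = Φ a := by
  obtain ⟨j, hj⟩ := I.exists_pow_inf_eq_pow_smul (LinearMap.range Φ)
  refine ⟨j + k, fun a ha => ?_⟩
  have h1 : Φ a ∈ I ^ (j + k) • ⊤ ⊓ LinearMap.range Φ := ⟨ha, a, rfl⟩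
  rw [hj _ (Nat.le_add_right j k), Nat.add_sub_cancel_left] at h1
  have h2 := Submodule.smul_mono le_rfl inf_le_right h1
  rw [LinearMap.range_eq_map, ← Submodule.map_smul''] at h2
  exact h2

theorem pi_mem_smul_top {B P ι : Type*} [Finite ι] [CommRing B] [AddCommGroup P] [Module B P]
    (I : Ideal B) {v : ι → P} (h : ∀ i, v i ∈ (I • ⊤ : Submodule B P)) :
    v ∈ (I • ⊤ : Submodule B (ι → P)) := by
  classical
  have := Fintype.ofFinite ι
  rw [← Finset.univ_sum_single v]
  refine Submodule.sum_mem _ fun i _ => ?_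
  have h2 := Submodule.mem_map_of_mem (f := LinearMap.single B (fun _ : ι => P) i) (h i)
  rw [Submodule.map_smul''] at h2
  exact Submodule.smul_mono le_rfl le_top h2

/-- The `p`-th power of a non-unit of `A` comes from a non-unit of `B`, so the maximal ideal of `A`
lies in the radical of the extension of that of `B`. Being finitely generated, it has a power inside
this extension. -/
theorem exists_pow_le_pow_smul_top {B A : Type*} [CommRing B] [IsLocalRing B] [CommRing A]
    [IsLocalRing A] [IsNoetherianRing A] [Algebra B A] {p : ℕ} (hp : p ≠ 0)
    (hpow : ∀ a : A, ∃ b : B, algebraMap B A b = a ^ p) (k : ℕ) :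
    ∃ n : ℕ, ∀ a ∈ maximalIdeal A ^ n, a ∈ (maximalIdeal B ^ k • ⊤ : Submodule B A) := by
  have h : maximalIdeal A ≤ ((maximalIdeal B).map (algebraMap B A)).radical := by
    intro a ha
    obtain ⟨b, hb⟩ := hpow a
    refine ⟨p + 1, ?_⟩
    rw [pow_succ, ← hb]
    by_cases hbu : IsUnit b
    · have h1 := hbu.map (algebraMap B A)
      rw [hb] at h1
      exact absurd ((isUnit_pow_iff hp).mp h1) ((mem_maximalIdeal a).mp ha)
    · exact Ideal.mul_mem_right _ _ (Ideal.mem_map_of_mem _ ((mem_maximalIdeal b).mpr hbu))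
  obtain ⟨n, hn⟩ := Ideal.exists_pow_le_of_le_radical_of_fg h
    (IsNoetherian.noetherian (maximalIdeal A))
  refine ⟨n * k, fun a ha => ?_⟩
  rw [Ideal.smul_top_eq_map, Submodule.restrictScalars_mem, Ideal.map_pow]
  rw [pow_mul] at ha
  exact Ideal.pow_right_mono hn k ha

/-! ### Passing between a module of derivations and its multiplicative frame. -/

section invariants
variable {R A : Type*} [CommRing R] [CommRing A] [Algebra R A]

/-- The module generated by the continuous extensions to the `I`-adic completion of the elements of
a module of derivations. -/
noncomputable abbrev completedSpan (I : Ideal A) (F : Submodule A (Derivation R A A)) :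
    Submodule (AdicCompletion I A) (Derivation R (AdicCompletion I A) (AdicCompletion I A)) :=
  Submodule.span _ {E | ∃ D ∈ F, ∀ a : A,
    E (algebraMap A (AdicCompletion I A) a) = algebraMap A (AdicCompletion I A) (D a)}

/-- The commuting multiplicative derivations `G` of the completion generate, up to saturation, the
completion of `F`. -/
structure IsMultiplicativeFrame (p : ℕ) (I : Ideal A) (F : Submodule A (Derivation R A A))
    (G : Finset (Derivation R (AdicCompletion I A) (AdicCompletion I A))) : Prop where
  mult : ∀ E ∈ G, ∃ u : (AdicCompletion I A)ˣ, ∀ a, (⇑E)^[p] a = u * E a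
  comm : ∀ E ∈ G, ∀ E' ∈ G, ⁅E, E'⁆ = 0
  mem_iff : ∀ E, E ∈ completedSpan I F ↔ ∃ a ∈ nonZeroDivisors (AdicCompletion I A),
    a • E ∈ Submodule.span (AdicCompletion I A)
      (G : Set (Derivation R (AdicCompletion I A) (AdicCompletion I A)))

variable {p : ℕ} {I : Ideal A} {F : Submodule A (Derivation R A A)}
  {G : Finset (Derivation R (AdicCompletion I A) (AdicCompletion I A))}

/-- The extension of `D` to the completion has a multiple, by a non-zero-divisor, in the span of
`G`; hence it kills `c`. Reading this at level `n` gives the claim for a lift of `c`. -/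
theorem IsMultiplicativeFrame.apply_mem_pow (h : IsMultiplicativeFrame p I F G)
    {c : AdicCompletion I A} (hc : ∀ E ∈ G, E c = 0) {D : Derivation R A A} (hD : D ∈ F) {n : ℕ}
    {a : A} (ha : AdicCompletion.evalₐ I (n + 1) c = Ideal.Quotient.mk (I ^ (n + 1)) a) :
    D a ∈ I ^ n := by
  obtain ⟨D', hD'⟩ := exists_extend I D
  obtain ⟨x, hx, hxD⟩ := (h.mem_iff D').mp
    (Submodule.subset_span ⟨D, hD, extend_algebraMap I hD'⟩)
  have h1 : ∀ E ∈ Submodule.span (AdicCompletion I A)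
      (G : Set (Derivation R (AdicCompletion I A) (AdicCompletion I A))), E c = 0 := by
    intro E hE
    induction hE using Submodule.span_induction with
    | mem E hE => exact hc E hE
    | zero => rfl
    | add E E' _ _ h h' => rw [Derivation.add_apply, h, h', add_zero]
    | smul r E _ h => rw [Derivation.smul_apply, h, smul_zero]
  have h2 : D' c * x = 0 := by
    rw [mul_comm]
    exact h1 _ hxD
  have h3 := hD' c n a ha
  rw [(mul_right_mem_nonZeroDivisors_eq_zero_iff hx).mp h2, map_zero] at h3
  exact Ideal.Quotient.eq_zero_iff_mem.mp h3.symm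

/-- The converse passage: members of `G` lie in the saturation of their span, so they are
combinations of extensions of elements of `F`. -/
theorem IsMultiplicativeFrame.apply_mem_map (h : IsMultiplicativeFrame p I F G) (J : Ideal A)
    {a : A} (ha : ∀ D ∈ F, D a ∈ J) : ∀ E ∈ G, E (algebraMap A (AdicCompletion I A) a) ∈
      J.map (algebraMap A (AdicCompletion I A)) := by
  intro E hE
  have hE' : E ∈ completedSpan I F := (h.mem_iff E).mpr
    ⟨1, one_mem _, by rw [one_smul]; exact Submodule.subset_span hE⟩
  clear hE
  induction hE' using Submodule.span_induction with
  | mem E hE =>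
    obtain ⟨D, hD, hDE⟩ := hE
    rw [hDE]
    exact Ideal.mem_map_of_mem _ (ha D hD)
  | zero => exact Ideal.zero_mem _
  | add E E' _ _ h h' => exact Ideal.add_mem _ h h'
  | smul r E _ h => exact Ideal.mul_mem_left _ _ h

theorem IsMultiplicativeFrame.projector_apply_algebraMap (h : IsMultiplicativeFrame p I F G)
    {π : AdicCompletion I A →ₗ[R] AdicCompletion I A}
    (hπ : ∀ J : Ideal (AdicCompletion I A), (∀ E ∈ G, ∀ c ∈ J, E c ∈ J) →
      ∀ c, (∀ E ∈ G, E c ∈ J) → π c - c ∈ J) {a : A} (ha : ∀ D ∈ F, D a = 0) :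
    π (algebraMap A _ a) = algebraMap A _ a := by
  rw [← sub_eq_zero, ← Ideal.mem_bot]
  refine hπ ⊥ (fun E _ c hc => ?_) _ fun E hE => ?_
  · rw [Ideal.mem_bot.mp hc, map_zero]; exact Ideal.zero_mem _
  · have h2 := h.apply_mem_map ⊥ (fun D hD => by rw [ha D hD]; exact Ideal.zero_mem _) E hE
    rwa [Ideal.map_bot] at h2

/-- Derivations are linear over the base, so ideals extended from it are stable, as
`exists_projector` requires. -/
theorem derivation_mem_map (E : Derivation R A A) (J : Ideal R) {c : A}
    (hc : c ∈ J.map (algebraMap R A)) : E c ∈ J.map (algebraMap R A) := by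
  rw [Ideal.map] at hc
  induction hc using Submodule.span_induction with
  | mem c hc =>
    obtain ⟨r, -, rfl⟩ := hc
    rw [E.map_algebraMap]
    exact Ideal.zero_mem _
  | zero => rw [map_zero]; exact Ideal.zero_mem _
  | add c c' _ _ h h' => rw [map_add]; exact Ideal.add_mem _ h h'
  | smul r c h h' =>
    rw [smul_eq_mul, E.leibniz]
    exact Ideal.add_mem _ (Ideal.mul_mem_left _ _ h') (Ideal.mul_mem_right _ _ h)

end invariants

theorem algHom_linearMap_mul {R A C Q : Type*} [CommRing R] [CommRing A] [CommRing C] [CommRing Q]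
    [Algebra R A] [Algebra R C] [Algebra A C] [Algebra A Q] [IsScalarTower R A C]
    (θ : C →ₐ[A] Q) (π : C →ₗ[R] C) (r : R) (a : A) :
    θ (π (algebraMap A C (algebraMap R A r * a))) =
      algebraMap A Q (algebraMap R A r) * θ (π (algebraMap A C a)) := by
  rw [map_mul (algebraMap A C), ← IsScalarTower.algebraMap_apply, ← Algebra.smul_def, map_smul,
    Algebra.smul_def, IsScalarTower.algebraMap_apply R A C, map_mul, θ.commutes]

/-! ### Descent from the completion: the three algebraic assertions. -/

section descent
variable {R B A : Type*} [CommRing R] [CommRing B] [CommRing A] [IsLocalRing A]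
  [IsNoetherianRing A] [IsLocalRing B] [IsNoetherianRing B] [Algebra R A] [Algebra B A]
  [Module.Finite B A] {p : ℕ} {F : Submodule A (Derivation R A A)}
  {G : Finset (Derivation R (AdicCompletion (maximalIdeal A) A)
    (AdicCompletion (maximalIdeal A) A))}

/-- The invariants of the completion are limits of invariants. -/
theorem IsMultiplicativeFrame.exists_algHom
    (h : IsMultiplicativeFrame p (maximalIdeal A) F G) (hp : p ≠ 0) (hF : F.FG)
    (hB : ∀ a : A, (∃ b : B, algebraMap B A b = a) ↔ ∀ D ∈ F, D a = 0)
    (hpow : ∀ a : A, ∃ b : B, algebraMap B A b = a ^ p) (k : ℕ) :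
    ∃ θ : AdicCompletion (maximalIdeal A) A →ₐ[A] A ⧸ (maximalIdeal B ^ k).map (algebraMap B A),
      ∀ c, (∀ E ∈ G, E c = 0) → ∃ b : B, θ c = Ideal.Quotient.mk _ (algebraMap B A b) := by
  obtain ⟨S, hS⟩ := hF
  -- Evaluation of finitely many generators of `F`. It is `B`-linear because `B` is killed by `F`,
  -- and its kernel is `B`.
  let Φ : A →ₗ[B] (S → A) :=
    { toFun := fun a D => D.1 a
      map_add' := fun a a' => funext fun D => map_add _ _ _
      map_smul' := fun b a => funext fun D => by
        have h1 := (hB (algebraMap B A b)).mp ⟨b, rfl⟩ D.1 (hS ▸ Submodule.subset_span D.2)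
        rw [Algebra.smul_def, D.1.leibniz, h1, smul_zero, add_zero, RingHom.id_apply, Pi.smul_apply,
          smul_eq_mul, Algebra.smul_def] }
  -- The exponent `j` is the Artin-Rees precision needed for an error of order `k`; `m` makes the
  -- map `θ` well defined, and `n` converts precision in `A` to precision `j` over `B`.
  obtain ⟨j, hj⟩ := exists_mem_smul_top_of_map_mem (maximalIdeal B) Φ k
  obtain ⟨m, hm⟩ := exists_pow_le_pow_smul_top (B := B) hp hpow k
  obtain ⟨n, hn⟩ := exists_pow_le_pow_smul_top (B := B) hp hpow j
  have hm' : maximalIdeal A ^ m ≤ (maximalIdeal B ^ k).map (algebraMap B A) := fun a ha => by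
    have h1 := hm a ha
    rwa [Ideal.smul_top_eq_map] at h1
  refine ⟨(Ideal.Quotient.factorₐ A hm').comp (AdicCompletion.evalₐ _ m), fun c hc => ?_⟩
  -- The extra level pays for the power lost when `a` is differentiated.
  obtain ⟨a, ha⟩ := exists_evalₐ_eq _ c (max m n + 1)
  obtain ⟨a', ha', haa'⟩ := hj a (pi_mem_smul_top _ fun D => hn _ (Ideal.pow_le_pow_right
    (le_max_right m n) (h.apply_mem_pow hc (hS ▸ Submodule.subset_span D.2) ha)))
  -- The correction `a'` is small and has the same derivatives as `a`, so `a - a'` is an honest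
  -- invariant close to `c`.
  obtain ⟨b, hb⟩ := (hB (a - a')).mpr fun D hD => by
    rw [← hS] at hD
    induction hD using Submodule.span_induction with
    | mem D hD => rw [map_sub, sub_eq_zero]; exact (congrFun haa' ⟨D, hD⟩).symm
    | zero => rfl
    | add E E' _ _ h h' => rw [Derivation.add_apply, h, h', add_zero]
    | smul r E _ h => rw [Derivation.smul_apply, h, smul_zero]
  refine ⟨b, ?_⟩
  rw [AlgHom.comp_apply, evalₐ_of_le _ ((le_max_left m n).trans (Nat.le_succ _)) ha, hb]
  refine Ideal.Quotient.eq.mpr ?_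
  rw [sub_sub_cancel]
  rwa [Ideal.smul_top_eq_map] at ha'

/-- The functions which are invariant modulo an ideal of the base lift to invariants. -/
theorem IsMultiplicativeFrame.exists_sub_mem
    (h : IsMultiplicativeFrame p (maximalIdeal A) F G) (hp : 2 ≤ p) (hF : F.FG)
    (hB : ∀ a : A, (∃ b : B, algebraMap B A b = a) ↔ ∀ D ∈ F, D a = 0)
    (hpow : ∀ a : A, ∃ b : B, algebraMap B A b = a ^ p) (J : Ideal R) {a : A}
    (ha : ∀ D ∈ F, D a ∈ J.map (algebraMap R A)) :
    ∃ b : B, a - algebraMap B A b ∈ J.map (algebraMap R A) := by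
  obtain ⟨π, hπ, hπ'⟩ := exists_projector hp G h.mult h.comm
  -- It suffices to approximate `a` by elements of the `B`-submodule `JA + B`. The image of `a`
  -- under `π` is invariant and congruent to `a` modulo the extension of `J`, and `θ` brings both
  -- facts back to `A`.
  have hmem : a ∈ (J.map (algebraMap R A)).restrictScalars B ⊔
      LinearMap.range (Algebra.linearMap B A) := by
    refine mem_of_forall_exists_sub_mem _ fun k => ?_
    obtain ⟨θ, hθ⟩ := h.exists_algHom (by omega) hF hB hpow k
    obtain ⟨b, hb⟩ := hθ (π (algebraMap A _ a)) (hπ _)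
    have h1 : π (algebraMap A _ a) - algebraMap A _ a ∈
        (J.map (algebraMap R A)).map (algebraMap A (AdicCompletion (maximalIdeal A) A)) := by
      refine hπ' _ (fun E _ c hc => ?_) _ (h.apply_mem_map _ ha)
      rw [Ideal.map_map, ← IsScalarTower.algebraMap_eq] at hc ⊢
      exact derivation_mem_map E J hc
    have h2 := Ideal.mem_map_of_mem θ.toRingHom h1
    rw [Ideal.map_map] at h2
    have h3 : θ.toRingHom.comp (algebraMap A (AdicCompletion (maximalIdeal A) A)) =
      Ideal.Quotient.mk ((maximalIdeal B ^ k).map (algebraMap B A)) := θ.comp_algebraMap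
    rw [h3] at h2
    obtain ⟨x, hx, hxe⟩ := (Ideal.mem_map_iff_of_surjective _ Ideal.Quotient.mk_surjective).mp h2
    have h4 : θ.toRingHom (π (algebraMap A _ a) - algebraMap A _ a) =
      Ideal.Quotient.mk _ (algebraMap B A b) - Ideal.Quotient.mk _ a :=
      (map_sub θ _ _).trans (congrArg₂ _ hb (θ.commutes a))
    rw [h4, ← map_sub, Ideal.Quotient.eq] at hxe
    refine ⟨- x + algebraMap B A b, Submodule.add_mem_sup (neg_mem hx) ⟨b, rfl⟩, ?_⟩
    rw [Ideal.smul_top_eq_map, Submodule.restrictScalars_mem]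
    convert hxe using 1
    ring
  obtain ⟨x, hx, _, ⟨b, rfl⟩, hxb⟩ := Submodule.mem_sup.mp hmem
  refine ⟨b, ?_⟩
  rw [← hxb, Algebra.linearMap_apply, add_sub_cancel_right]
  exact hx

variable [Algebra R B] [IsScalarTower R B A]

/-- The invariants are flat over the base. -/
theorem IsMultiplicativeFrame.flat
    (h : IsMultiplicativeFrame p (maximalIdeal A) F G) (hp : 2 ≤ p) (hF : F.FG)
    (hB : ∀ a : A, (∃ b : B, algebraMap B A b = a) ↔ ∀ D ∈ F, D a = 0)
    (hpow : ∀ a : A, ∃ b : B, algebraMap B A b = a ^ p)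
    (hinj : Function.Injective (algebraMap B A)) [Module.Flat R A] : Module.Flat R B := by
  obtain ⟨π, hπ, hπ'⟩ := exists_projector hp G h.mult h.comm
  -- Equational criterion: flatness of `A` trivializes a relation in `B` through elements `y j` of
  -- `A`, and these have to be replaced by elements of `B` with the same coefficients `r`.
  refine Module.Flat.of_forall_isTrivialRelation fun {l f x} hfx => ?_
  obtain ⟨κ, r, y, hxy, hr⟩ := Module.Flat.isTrivialRelation_of_sum_smul_eq_zero (R := R) (M := A)
    (f := f) (x := fun i => algebraMap B A (x i)) (by
      have h1 := congrArg (algebraMap B A) hfx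
      rw [map_sum, map_zero] at h1
      rw [← h1]
      refine Finset.sum_congr rfl fun i _ => ?_
      rw [Algebra.smul_def, Algebra.smul_def, map_mul, ← IsScalarTower.algebraMap_apply])
  let Φ : (Fin κ → B) →ₗ[B] (Fin l → A) :=
    { toFun := fun b i => algebraMap B A (∑ j, r i j • b j)
      map_add' := fun b b' => funext fun i => by
        simp only [Pi.add_apply, smul_add, Finset.sum_add_distrib, map_add]
      map_smul' := fun c b => funext fun i => by
        rw [RingHom.id_apply, Pi.smul_apply, Algebra.smul_def c (algebraMap B A _), ← map_mul, Finset.mul_sum]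
        simp only [Pi.smul_apply, smul_eq_mul, Algebra.smul_def, mul_left_comm c] }
  -- Solvability of the system over `B` is membership in the range of `Φ`. Since `π` is `R`-linear
  -- and fixes each `x i`, the elements `π (y j)` solve the same system; their approximations in `B`
  -- solve it modulo any power.
  have hmem : (fun i => algebraMap B A (x i)) ∈ LinearMap.range Φ := by
    refine mem_of_forall_exists_sub_mem _ fun k => ?_
    obtain ⟨θ, hθ⟩ := h.exists_algHom (by omega) hF hB hpow k
    choose b hb using fun j => hθ (π (algebraMap A _ (y j))) (hπ _)
    refine ⟨Φ b, ⟨b, rfl⟩, pi_mem_smul_top _ fun i => ?_⟩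
    rw [Ideal.smul_top_eq_map, Submodule.restrictScalars_mem]
    refine Ideal.Quotient.eq.mp ?_
    have h1 : π (algebraMap A _ (algebraMap B A (x i))) = algebraMap A _ (algebraMap B A (x i)) :=
      h.projector_apply_algebraMap hπ' ((hB _).mp ⟨x i, rfl⟩)
    have h3 := congrArg θ h1
    rw [θ.commutes] at h3
    change algebraMap A _ (algebraMap B A (x i)) = algebraMap A _ (algebraMap B A (∑ j, r i j • b j))
    rw [← h3, show algebraMap B A (x i) = _ from hxy i, map_sum, map_sum, map_sum, map_sum, map_sum]
    refine Finset.sum_congr rfl fun j _ => ?_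
    rw [Algebra.smul_def, Algebra.smul_def, algHom_linearMap_mul, hb, map_mul, map_mul,
      ← IsScalarTower.algebraMap_apply R B A]
    rfl
  obtain ⟨b, hb⟩ := hmem
  exact ⟨κ, r, b, fun i => hinj (congrFun hb i).symm, hr⟩

/-- The invariants modulo an ideal of the base inject into the functions modulo that ideal. -/
theorem IsMultiplicativeFrame.mem_map_of_algebraMap_mem
    (h : IsMultiplicativeFrame p (maximalIdeal A) F G) (hp : 2 ≤ p) (hF : F.FG)
    (hB : ∀ a : A, (∃ b : B, algebraMap B A b = a) ↔ ∀ D ∈ F, D a = 0)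
    (hpow : ∀ a : A, ∃ b : B, algebraMap B A b = a ^ p)
    (hinj : Function.Injective (algebraMap B A)) (J : Ideal R) {b : B}
    (hb : algebraMap B A b ∈ J.map (algebraMap R A)) : b ∈ J.map (algebraMap R B) := by
  obtain ⟨π, hπ, hπ'⟩ := exists_projector hp G h.mult h.comm
  have hmem : algebraMap B A b ∈
      Submodule.map (Algebra.linearMap B A) (J.map (algebraMap R B)) := by
    refine mem_of_forall_exists_sub_mem _ fun k => ?_
    obtain ⟨θ, hθ⟩ := h.exists_algHom (by omega) hF hB hpow k
    -- The multiplier `a` is part of the induction because `π` is not `A`-linear: only coefficients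
    -- from `R` can be pulled out. The case used is `a = 1`, with `x` the invariant `b`, which `π`
    -- fixes.
    have h1 : ∀ x ∈ J.map (algebraMap R A), ∀ a : A, ∃ b ∈ J.map (algebraMap R B),
        θ (π (algebraMap A _ (a * x))) = Ideal.Quotient.mk _ (algebraMap B A b) := by
      intro x hx
      rw [Ideal.map] at hx
      induction hx using Submodule.span_induction with
      | mem x hx =>
        obtain ⟨r, hr, rfl⟩ := hx
        intro a
        obtain ⟨b, hb⟩ := hθ (π (algebraMap A _ a)) (hπ _)
        refine ⟨algebraMap R B r * b, Ideal.mul_mem_right _ _ (Ideal.mem_map_of_mem _ hr), ?_⟩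
        rw [mul_comm, algHom_linearMap_mul, hb, map_mul, map_mul,
          ← IsScalarTower.algebraMap_apply R B A]
        rfl
      | zero => exact fun a => ⟨0, Ideal.zero_mem _, by simp⟩
      | add x y _ _ hx hy =>
        intro a
        obtain ⟨b, hb, h1⟩ := hx a
        obtain ⟨c, hc, h2⟩ := hy a
        refine ⟨b + c, Ideal.add_mem _ hb hc, ?_⟩
        rw [mul_add, map_add, map_add, map_add, h1, h2, map_add, map_add]
      | smul c x _ hx =>
        intro a
        rw [smul_eq_mul, ← mul_assoc]
        exact hx (a * c)
    obtain ⟨c, hc, hce⟩ := h1 _ hb 1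
    refine ⟨algebraMap B A c, ⟨c, hc, rfl⟩, ?_⟩
    rw [Ideal.smul_top_eq_map, Submodule.restrictScalars_mem, ← Ideal.Quotient.eq, ← hce, one_mul]
    have h1 : π (algebraMap A _ (algebraMap B A b)) = algebraMap A _ (algebraMap B A b) :=
      h.projector_apply_algebraMap hπ' ((hB _).mp ⟨b, rfl⟩)
    rw [h1, θ.commutes]
    rfl
  obtain ⟨c, hc, hce⟩ := hmem
  rwa [← hinj hce]

end descent

/-! ### Local rings and affine charts of the quotient; finiteness. -/

section charts
variable {X S : Scheme.{u}} {f : X ⟶ S} (F : StalkFamily f)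

/-- Near `x` the sheaf is generated by finitely many vector fields. Each sends `a` to a section with
zero germ at `x`, which vanishes on a neighbourhood; the finite intersection of these carries an
invariant section. -/
theorem exists_germ_eq_of_isCoherent (hF : IsCoherent F) (x : X) (a : X.presheaf.stalk x)
    (ha : ∀ D ∈ F x, D a = 0) :
    ∃ (W : X.Opens) (hx : x ∈ W) (b : invariants F W), X.presheaf.germ W x hx b.1 = a := by
  obtain ⟨U, hxU, a, rfl⟩ := X.presheaf.exists_germ_eq a
  obtain ⟨U₀, hxU₀, n, D, hD, hspan⟩ := hF x
  have hW : ∀ i, ∃ W : X.Opens, x ∈ W ∧ W ≤ U ⊓ U₀ ∧ ∀ (y : X) (hy : y ∈ W) (hyU : y ∈ U),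
      D i y (X.presheaf.germ U y hyU a) = 0 := by
    intro i
    obtain ⟨b, hb⟩ := hD i (U ⊓ U₀) inf_le_right (X.presheaf.map (homOfLE inf_le_left).op a)
    have hx' : x ∈ U ⊓ U₀ := ⟨hxU, hxU₀⟩
    have hb0 : X.presheaf.germ (U ⊓ U₀) x hx' b = X.presheaf.germ (U ⊓ U₀) x hx' 0 := by
      rw [hb x hx', TopCat.Presheaf.germ_res_apply, map_zero]
      refine ha _ ?_
      rw [hspan x hxU₀]
      exact Submodule.subset_span ⟨i, rfl⟩
    obtain ⟨W, hxW, j, j', hjj⟩ := X.presheaf.germ_eq x _ _ b 0 hb0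
    refine ⟨W, hxW, j.le, fun y hy hyU => ?_⟩
    have h1 := hb y (j.le hy)
    rw [TopCat.Presheaf.germ_res_apply] at h1
    rw [← h1, ← TopCat.Presheaf.germ_res_apply X.presheaf j y hy b, hjj, map_zero, map_zero]
  choose W hxW hWU hW using hW
  let V : X.Opens := ⟨⋂ i, (W i : Set X), isOpen_iInter_of_finite fun i => (W i).isOpen⟩ ⊓ (U ⊓ U₀)
  have hVW : ∀ i, V ≤ W i := fun i => inf_le_left.trans fun _ hy => Set.mem_iInter.mp hy i
  have hxV : x ∈ V := ⟨Set.mem_iInter.mpr hxW, hxU, hxU₀⟩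
  have hVU : V ≤ U := inf_le_right.trans inf_le_left
  refine ⟨V, hxV, ⟨X.presheaf.map (homOfLE hVU).op a, fun y hy E hE => ?_⟩,
    TopCat.Presheaf.germ_res_apply _ _ _ _ _⟩
  rw [TopCat.Presheaf.germ_res_apply]
  rw [hspan y hy.2.2] at hE
  induction hE using Submodule.span_induction with
  | mem E hE =>
    obtain ⟨i, rfl⟩ := hE
    exact hW i y (hVW i hy) (hVU hy)
  | zero => rfl
  | add E E' _ _ h h' => rw [Derivation.add_apply, h, h', add_zero]
  | smul r E _ h => rw [Derivation.smul_apply, h, smul_zero]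

variable {p : ℕ} [hpp : Fact p.Prime] (hp : (p : Γ(X, ⊤)) = 0) (hF : IsCoherent F)

theorem quotientProj_stalkMap_injective (x : X) :
    Function.Injective ((quotientProj F hp hF).stalkMap x).hom :=
  stalkMap_injective F x

theorem exists_quotientProj_stalkMap_eq_iff (x : X) (a : X.presheaf.stalk x) :
    (∃ b, ((quotientProj F hp hF).stalkMap x).hom b = a) ↔ ∀ D ∈ F x, D a = 0 := by
  constructor
  · rintro ⟨b, rfl⟩ D hD
    obtain ⟨U, hx, b, rfl⟩ := (quotPresheaf F).exists_germ_eq b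
    have h : ((quotientProj F hp hF).stalkMap x).hom ((quotPresheaf F).germ U x hx b) =
      X.presheaf.germ U x hx b.1 := stalkMap_germ F U x hx b
    exact (congrArg D h).trans (b.2 x hx D hD)
  · intro ha
    obtain ⟨W, hx, b, rfl⟩ := exists_germ_eq_of_isCoherent F hF x a ha
    exact ⟨(quotPresheaf F).germ W x hx b, stalkMap_germ F W x hx b⟩

theorem stalk_pow_mem (x : X) (a : X.presheaf.stalk x) :
    ∃ b, ((quotientProj F hp hF).stalkMap x).hom b = a ^ p :=
  (exists_quotientProj_stalkMap_eq_iff F hp hF x _).mpr fun D _ => derivation_pow hp x D a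

theorem quotientProj_app_injective (V : (quotient F hp hF).Opens) :
    Function.Injective ((quotientProj F hp hF).app V).hom :=
  fun _ _ h => Subtype.ext h

theorem exists_quotientProj_app_eq_pow (V : (quotient F hp hF).Opens)
    (a : Γ(X, quotientProj F hp hF ⁻¹ᵁ V)) :
    ∃ b, ((quotientProj F hp hF).app V).hom b = a ^ p :=
  ⟨(⟨a ^ p, pow_mem F hp _ a⟩ : invariants F (quotientProj F hp hF ⁻¹ᵁ V)), rfl⟩

/-- The quotient is covered by affine open subschemes with affine preimage. -/
theorem exists_isAffineOpen_preimage (x : X) {W : S.Opens} (hW : f x ∈ W) :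
    ∃ V : (quotient F hp hF).Opens, quotientProj F hp hF x ∈ V ∧ IsAffineOpen V ∧
      IsAffineOpen (quotientProj F hp hF ⁻¹ᵁ V) ∧ V ≤ quotientMap F hp hF ⁻¹ᵁ W := by
  obtain ⟨_, ⟨V, hV, rfl⟩, hxV, hVW⟩ :=
    (quotient F hp hF).isBasis_affineOpens.exists_subset_of_mem_open
      (a := quotientProj F hp hF x) (show quotientProj F hp hF x ∈ quotientMap F hp hF ⁻¹ᵁ W from hW)
      (quotientMap F hp hF ⁻¹ᵁ W).isOpen
  replace hV : IsAffineOpen V := hV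
  replace hVW : V ≤ quotientMap F hp hF ⁻¹ᵁ W := hVW
  obtain ⟨_, ⟨U, hU, rfl⟩, hxU, hUV⟩ := X.isBasis_affineOpens.exists_subset_of_mem_open
    (show x ∈ quotientProj F hp hF ⁻¹ᵁ V from hxV) (quotientProj F hp hF ⁻¹ᵁ V).isOpen
  replace hU : IsAffineOpen U := hU
  replace hUV : U ≤ quotientProj F hp hF ⁻¹ᵁ V := hUV
  -- The quotient has the same underlying space, so the affine open `U` of `X` is also open there. A
  -- basic open inside it is then basic both in `V` and in `U`, hence affine on both sides.
  obtain ⟨b, hbU, hxb⟩ := hV.exists_basicOpen_le (V := (show (quotient F hp hF).Opens from U))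
    ⟨quotientProj F hp hF x, hxU⟩ hxV
  refine ⟨(quotient F hp hF).basicOpen b, hxb, hV.basicOpen b, ?_,
    ((quotient F hp hF).basicOpen_le b).trans hVW⟩
  have h1 : quotientProj F hp hF ⁻¹ᵁ (quotient F hp hF).basicOpen b ≤ U := hbU
  have h2 := hU.basicOpen (X.presheaf.map (homOfLE hUV).op ((quotientProj F hp hF).app V b))
  rw [Scheme.basicOpen_res] at h2
  rw [Scheme.preimage_basicOpen] at h1 ⊢
  rwa [inf_eq_right.mpr h1] at h2

theorem appLE_comp_app (W : S.Opens) (V : (quotient F hp hF).Opens)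
    (h : V ≤ quotientMap F hp hF ⁻¹ᵁ W) :
    ((quotientProj F hp hF).app V).hom.comp ((quotientMap F hp hF).appLE W V h).hom =
      (f.appLE W (quotientProj F hp hF ⁻¹ᵁ V) ((quotientProj F hp hF).preimage_mono h)).hom := by
  have h1 := Scheme.Hom.appLE_comp_appLE (quotientProj F hp hF) (quotientMap F hp hF) W V
    (quotientProj F hp hF ⁻¹ᵁ V) h le_rfl
  rw [Scheme.Hom.app_eq_appLE, ← CommRingCat.hom_comp, h1]
  rfl

/-- Finite type over the base, and integral because `p`-th powers are invariant. -/
theorem quotientProj_app_finite [LocallyOfFiniteType f] {W : S.Opens} (hW : IsAffineOpen W)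
    {V : (quotient F hp hF).Opens} (hV' : IsAffineOpen (quotientProj F hp hF ⁻¹ᵁ V))
    (h : V ≤ quotientMap F hp hF ⁻¹ᵁ W) : ((quotientProj F hp hF).app V).hom.Finite := by
  have h1 := f.finiteType_appLE hW hV' ((quotientProj F hp hF).preimage_mono h)
  rw [← appLE_comp_app F hp hF W V h] at h1
  refine RingHom.IsIntegral.to_finite (fun a => ?_) h1.of_comp_finiteType
  let := ((quotientProj F hp hF).app V).hom.toAlgebra
  obtain ⟨b, hb⟩ := exists_quotientProj_app_eq_pow F hp hF V a
  exact IsIntegral.of_pow hpp.out.pos (hb ▸ isIntegral_algebraMap (x := b))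

/-- The Artin-Tate lemma. It also makes the quotient locally Noetherian, which the descent arguments
require of `B`. -/
theorem locallyOfFiniteType_quotientMap [LocallyOfFiniteType f] [IsLocallyNoetherian S] :
    LocallyOfFiniteType (quotientMap F hp hF) := by
  rw [HasRingHomProperty.iff_exists_appLE (P := @LocallyOfFiniteType)
    (RingHom.finiteType_stableUnderComposition.stableUnderCompositionWithLocalizationAway
      RingHom.finiteType_holdsForLocalizationAway).left]
  intro x
  obtain ⟨_, ⟨W, hW, rfl⟩, hxW, -⟩ := S.isBasis_affineOpens.exists_subset_of_mem_open
    (show f x ∈ (⊤ : S.Opens) from trivial) isOpen_univ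
  replace hW : IsAffineOpen W := hW
  obtain ⟨V, hxV, hV, hV', hVW⟩ := exists_isAffineOpen_preimage F hp hF x hxW
  refine ⟨⟨W, hW⟩, ⟨V, hV⟩, hxV, hVW, ?_⟩
  have h1 := f.finiteType_appLE hW hV' ((quotientProj F hp hF).preimage_mono hVW)
  rw [← appLE_comp_app F hp hF W V hVW] at h1
  have h2 := quotientProj_app_finite F hp hF hW hV' hVW
  have : IsNoetherianRing Γ(S, W) := IsLocallyNoetherian.component_noetherian ⟨W, hW⟩
  algebraize [((quotientMap F hp hF).appLE W V hVW).hom, ((quotientProj F hp hF).app V).hom,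
    ((quotientProj F hp hF).app V).hom.comp ((quotientMap F hp hF).appLE W V hVW).hom]
  exact ⟨fg_of_fg_of_fg Γ(S, W) Γ(quotient F hp hF, V) Γ(X, quotientProj F hp hF ⁻¹ᵁ V)
    ‹Algebra.FiniteType _ _›.out ‹Module.Finite _ _›.fg_top (quotientProj_app_injective F hp hF V)⟩

end charts

/-- A fraction `a / s` equals `a s ^ (p - 1) / s ^ p`, whose denominator comes from `B₀` and is a
unit in `B` because `φ` is local. So generators of `A₀` over `B₀` still generate. -/
theorem finite_of_localization {B₀ A₀ B A : Type*} [CommRing B₀] [CommRing A₀] [CommRing B]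
    [CommRing A] {φ₀ : B₀ →+* A₀} {φ : B →+* A} (j : B₀ →+* B) (i : A₀ →+* A)
    (hij : i.comp φ₀ = φ.comp j) (hφ : φ₀.Finite) (hloc : IsLocalHom φ) {p : ℕ} (hp : p ≠ 0)
    (hpow : ∀ a, ∃ b, φ₀ b = a ^ p) (hi : ∀ y, ∃ a s, IsUnit (i s) ∧ y * i s = i a) :
    φ.Finite := by
  classical
  algebraize [φ₀, φ]
  obtain ⟨t, ht⟩ := ‹Module.Finite B₀ A₀›.fg_top
  refine ⟨⟨t.image i, ?_⟩⟩
  rw [eq_top_iff]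
  rintro y -
  obtain ⟨a, s, hs, hy⟩ := hi y
  obtain ⟨q, rfl⟩ : ∃ q, p = q + 1 := Nat.exists_eq_succ_of_ne_zero hp
  obtain ⟨b, hb⟩ := hpow s
  have h1 : φ (j b) = i s ^ (q + 1) := by rw [← RingHom.comp_apply, ← hij, RingHom.comp_apply, hb, map_pow]
  have h2 : IsUnit (j b) := hloc.map_nonunit _ (h1 ▸ hs.pow _)
  obtain ⟨c, hc⟩ := h2.exists_right_inv
  have h3 : y = c • i (a * s ^ q) := by
    have h4 := congrArg φ hc
    rw [map_mul, map_one, h1] at h4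
    rw [Algebra.smul_def, map_mul, map_pow, ← hy]
    change y = φ c * _
    linear_combination -y * h4
  rw [h3]
  refine Submodule.smul_mem _ _ ?_
  have h5 : a * s ^ q ∈ Submodule.span B₀ (t : Set A₀) := ht ▸ Submodule.mem_top
  generalize a * s ^ q = a' at h5
  induction h5 using Submodule.span_induction with
  | mem x hx => exact Submodule.subset_span (Finset.mem_coe.mpr (Finset.mem_image_of_mem i hx))
  | zero => rw [map_zero]; exact Submodule.zero_mem _
  | add x y _ _ h h' => rw [map_add]; exact Submodule.add_mem _ h h'
  | smul r x _ h =>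
    have h6 : i (r • x) = j r • i x := by
      rw [Algebra.smul_def, Algebra.smul_def, map_mul]
      exact congrArg (· * i x) congr($hij r)
    rw [h6]
    exact Submodule.smul_mem _ _ h

theorem quotientProj_stalkMap_finite {X S : Scheme.{u}} {f : X ⟶ S} (F : StalkFamily f)
    {p : ℕ} [hpp : Fact p.Prime] (hp : (p : Γ(X, ⊤)) = 0) (hF : IsCoherent F)
    [LocallyOfFiniteType f] (x : X) : ((quotientProj F hp hF).stalkMap x).hom.Finite := by
  obtain ⟨_, ⟨W, hW, rfl⟩, hxW, -⟩ := S.isBasis_affineOpens.exists_subset_of_mem_open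
    (show f x ∈ (⊤ : S.Opens) from trivial) isOpen_univ
  replace hW : IsAffineOpen W := hW
  obtain ⟨V, hxV, hV, hV', hVW⟩ := exists_isAffineOpen_preimage F hp hF x hxW
  refine finite_of_localization ((quotient F hp hF).presheaf.germ V _ hxV).hom
    (X.presheaf.germ (quotientProj F hp hF ⁻¹ᵁ V) x hxV).hom ?_
    (quotientProj_app_finite F hp hF hW hV' hVW) inferInstance hpp.out.ne_zero
    (exists_quotientProj_app_eq_pow F hp hF V) fun y => ?_
  · rw [← CommRingCat.hom_comp, ← CommRingCat.hom_comp, Scheme.Hom.germ_stalkMap]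
  · let := X.presheaf.algebra_section_stalk (U := quotientProj F hp hF ⁻¹ᵁ V) ⟨x, hxV⟩
    have := hV'.isLocalization_stalk ⟨x, hxV⟩
    obtain ⟨⟨a, s⟩, h⟩ := IsLocalization.surj (hV'.primeIdealOf ⟨x, hxV⟩).asIdeal.primeCompl y
    exact ⟨a, s, IsLocalization.map_units (X.presheaf.stalk x) s, h⟩

/-! ### From an isomorphism of local rings to an isomorphism near a point. -/

theorem fromSpecStalk_comp_eq {Y T : Scheme.{u}} {P : Y.Opens} {y : Y} (hy : y ∈ P)
    {a b : P.toScheme ⟶ T} (h : P.fromSpecStalkOfMem y hy ≫ a = P.fromSpecStalkOfMem y hy ≫ b) :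
    P.toScheme.fromSpecStalk ⟨y, hy⟩ ≫ a = P.toScheme.fromSpecStalk ⟨y, hy⟩ ≫ b := by
  have hι : ∀ x : P.toScheme, IsIso (P.ι.stalkMap x) := fun x => inferInstance
  have := hι ⟨y, hy⟩
  exact (cancel_epi (Spec.map (inv (P.ι.stalkMap ⟨y, hy⟩)))).mp h

/-- Here `t` is a section of `φ` over `U` and a retraction on `W'`. Over the points that `t` sends
into `W'`, injectivity puts the whole preimage in `W'`, so the restriction of `φ` is a monomorphism
with a section. -/
theorem isIsoAt_of_section {Y Z : Scheme.{u}} (φ : Y ⟶ Z) (hφ : Function.Injective φ) (y : Y)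
    (U : Z.Opens) (hyU : φ y ∈ U) (t : U.toScheme ⟶ Y) (htφ : t ≫ φ = U.ι)
    (W' : (φ ⁻¹ᵁ U).toScheme.Opens) (hyW' : (⟨y, hyU⟩ : (φ ⁻¹ᵁ U).toScheme) ∈ W')
    (hW' : W'.ι ≫ φ ∣_ U ≫ t = W'.ι ≫ (φ ⁻¹ᵁ U).ι) : IsIsoAt φ y := by
  have htφ' : ∀ u : U, φ (t u) = u.1 := fun u => congr($htφ u)
  let V : Z.Opens := U.ι ''ᵁ (t ⁻¹ᵁ ((φ ⁻¹ᵁ U).ι ''ᵁ W'))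
  have hVU : V ≤ U := U.ι_image_le _
  have hmem : ∀ w : Y, φ w ∈ V → w ∈ (φ ⁻¹ᵁ U).ι ''ᵁ W' := by
    rintro w ⟨u, hu, huw⟩
    have h3 : t u = w := hφ ((htφ' u).trans huw)
    rw [← h3]
    exact hu
  have hyV : φ y ∈ V := by
    refine ⟨⟨φ y, hyU⟩, ?_, rfl⟩
    have h3 : t ⟨φ y, hyU⟩ = y := hφ (htφ' _)
    change t ⟨φ y, hyU⟩ ∈ (φ ⁻¹ᵁ U).ι ''ᵁ W'
    rw [h3]
    exact ⟨⟨y, hyU⟩, hyW', rfl⟩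
  refine ⟨V, hyV, ?_⟩
  let i : (φ ⁻¹ᵁ V).toScheme ⟶ W'.toScheme :=
    IsOpenImmersion.lift (W'.ι ≫ (φ ⁻¹ᵁ U).ι) (φ ⁻¹ᵁ V).ι (by
      rintro _ ⟨w, rfl⟩
      obtain ⟨v, hv, hvw⟩ := hmem w.1 w.2
      exact ⟨⟨v, hv⟩, hvw⟩)
  have hi : i ≫ W'.ι ≫ (φ ⁻¹ᵁ U).ι = (φ ⁻¹ᵁ V).ι := IsOpenImmersion.lift_fac _ _ _
  have h4 : φ ∣_ V ≫ Z.homOfLE hVU = i ≫ W'.ι ≫ φ ∣_ U := by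
    rw [← cancel_mono U.ι, Category.assoc, Scheme.homOfLE_ι, morphismRestrict_ι, Category.assoc,
      Category.assoc, morphismRestrict_ι, ← hi, Category.assoc, Category.assoc]
  have h5 : φ ∣_ V ≫ Z.homOfLE hVU ≫ t = (φ ⁻¹ᵁ V).ι := by
    rw [reassoc_of% h4, hW', hi]
  have hmono : Mono (φ ∣_ V) := by
    have : Mono (φ ∣_ V ≫ Z.homOfLE hVU ≫ t) := h5 ▸ inferInstance
    exact mono_of_mono _ (Z.homOfLE hVU ≫ t)
  have hrange : Set.range (Z.homOfLE hVU ≫ t) ⊆ Set.range (φ ⁻¹ᵁ V).ι := by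
    rintro _ ⟨v, rfl⟩
    rw [Scheme.Opens.range_ι]
    have h6 : φ ((Z.homOfLE hVU ≫ t) v) = v.1 := by
      have h7 : (Z.homOfLE hVU ≫ t) ≫ φ = V.ι := by
        rw [Category.assoc, htφ, Scheme.homOfLE_ι]
      exact congr($h7 v)
    change φ _ ∈ V
    rw [h6]
    exact v.2
  have hsplit : IsSplitEpi (φ ∣_ V) := by
    refine ⟨⟨IsOpenImmersion.lift (φ ⁻¹ᵁ V).ι (Z.homOfLE hVU ≫ t) hrange, ?_⟩⟩
    rw [← cancel_mono V.ι, Category.assoc, morphismRestrict_ι, IsOpenImmersion.lift_fac_assoc,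
      Category.assoc, htφ, Scheme.homOfLE_ι, Category.id_comp]
  exact isIso_of_mono_of_isSplitEpi _

/-- The inverse of the stalk map is a section over the spectrum of the local ring, and finite type
lets it spread out. -/
theorem exists_section_of_isIso_stalkMap {Y Z : Scheme.{u}} (φ : Y ⟶ Z) [LocallyOfFiniteType φ]
    [IsLocallyNoetherian Z] (y : Y) [IsIso (φ.stalkMap y)] :
    ∃ (U : Z.Opens) (hyU : φ y ∈ U) (t : U.toScheme ⟶ Y),
      Spec.map (inv (φ.stalkMap y)) ≫ Y.fromSpecStalk y = U.fromSpecStalkOfMem (φ y) hyU ≫ t ∧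
      t ≫ φ = U.ι := by
  have h : (Spec.map (inv (φ.stalkMap y)) ≫ Y.fromSpecStalk y) ≫ φ =
      Z.fromSpecStalk (φ y) ≫ 𝟙 Z := by
    rw [Category.comp_id, Category.assoc, ← Scheme.SpecMap_stalkMap_fromSpecStalk,
      ← Spec.map_comp_assoc, IsIso.hom_inv_id, Spec.map_id, Category.id_comp]
  obtain ⟨U, hyU, t, ht, htφ⟩ := spread_out_of_isGermInjective' (𝟙 Z) φ (x := φ y) _ h
  exact ⟨U, hyU, t, ht, by rw [htφ, Category.comp_id]⟩

theorem fromSpecStalkOfMem_comp_section {Y Z : Scheme.{u}} (φ : Y ⟶ Z) (y : Y)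
    [IsIso (φ.stalkMap y)] (U : Z.Opens) (hyU : φ y ∈ U) (t : U.toScheme ⟶ Y)
    (ht : Spec.map (inv (φ.stalkMap y)) ≫ Y.fromSpecStalk y = U.fromSpecStalkOfMem (φ y) hyU ≫ t)
    (P : Y.Opens) (hyP : y ∈ P) (φ' : P.toScheme ⟶ U.toScheme)
    (hφ' : φ' ≫ U.ι = P.ι ≫ φ) :
    P.fromSpecStalkOfMem y hyP ≫ φ' ≫ t = P.fromSpecStalkOfMem y hyP ≫ P.ι := by
  have h1 : P.fromSpecStalkOfMem y hyP ≫ φ' =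
      Spec.map (φ.stalkMap y) ≫ U.fromSpecStalkOfMem (φ y) hyU := by
    rw [← cancel_mono U.ι, Category.assoc, hφ', Category.assoc,
      Scheme.Opens.fromSpecStalkOfMem_ι, Scheme.SpecMap_stalkMap_fromSpecStalk,
      Scheme.Opens.fromSpecStalkOfMem_ι_assoc]
  rw [reassoc_of% h1, ← ht, ← Spec.map_comp_assoc, IsIso.inv_hom_id, Spec.map_id,
    Category.id_comp, Scheme.Opens.fromSpecStalkOfMem_ι]

/-- An injective morphism of locally Noetherian schemes, locally of finite type, which is an
isomorphism on the local rings at a point is an isomorphism at that point. -/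
theorem isIsoAt_of_isIso_stalkMap {Y Z : Scheme.{u}} (φ : Y ⟶ Z) [LocallyOfFiniteType φ]
    [IsLocallyNoetherian Z] (hφ : Function.Injective φ) (y : Y)
    [IsIso (φ.stalkMap y)] : IsIsoAt φ y := by
  have : IsLocallyNoetherian Y := LocallyOfFiniteType.isLocallyNoetherian φ
  obtain ⟨U, hyU, t, ht, htφ⟩ := exists_section_of_isIso_stalkMap φ y
  have h2 := fromSpecStalkOfMem_comp_section φ y U hyU t ht _ hyU (φ ∣_ U)
    (morphismRestrict_ι φ U)
  have : IsLocallyNoetherian (φ ⁻¹ᵁ U).toScheme :=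
    isLocallyNoetherian_of_isOpenImmersion (φ ⁻¹ᵁ U).ι
  have hinj : ∀ x : (φ ⁻¹ᵁ U).toScheme, (φ ⁻¹ᵁ U).toScheme.IsGermInjectiveAt x :=
    fun x => inferInstance
  have := hinj ⟨y, hyU⟩
  obtain ⟨W', hyW', hW'⟩ := spread_out_unique_of_isGermInjective' _ _ (fromSpecStalk_comp_eq _ h2)
  exact isIsoAt_of_section φ hφ y U hyU t htφ W' hyW' hW'

/-! ### Local rings of a fiber as quotients of those of the total space. -/

theorem exists_eq_SpecMap_fromSpecStalk {Y : Scheme.{u}} {R : CommRingCat.{u}} [IsLocalRing R]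
    (l : Spec R ⟶ Y) {y : Y} (h : l (IsLocalRing.closedPoint R) = y) :
    ∃ ψ : Y.presheaf.stalk y ⟶ R, l = Spec.map ψ ≫ Y.fromSpecStalk y := by
  subst h
  exact ⟨_, (Scheme.Spec_stalkClosedPointTo_fromSpecStalk l).symm⟩

theorem eq_zero_of_not_isUnit_stalk_Spec (K : CommRingCat.{u}) (hK : IsField K)
    (x : PrimeSpectrum K) {a : (Spec.structureSheaf K).presheaf.stalk x}
    (ha : ¬ IsUnit a) : a = 0 := by
  obtain ⟨⟨b, s⟩, h⟩ := IsLocalization.surj (M := x.asIdeal.primeCompl)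
    (S := (Spec.structureSheaf K).presheaf.stalk x) a
  have hs := IsLocalization.map_units ((Spec.structureSheaf K).presheaf.stalk x) s
  have hb : b = 0 := by
    by_contra hb
    obtain ⟨c, hc⟩ := hK.mul_inv_cancel hb
    have h1 := (IsUnit.of_mul_eq_one c hc).map (algebraMap K ((Spec.structureSheaf K).presheaf.stalk x))
    rw [← h] at h1
    exact ha (isUnit_of_mul_isUnit_left h1)
  rw [hb, map_zero] at h
  exact hs.mul_left_eq_zero.mp h

section fiber
variable {X S : Scheme.{u}} (f : X ⟶ S) (s : S) (y : f.fiber s)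

theorem fiberι_stalkMap_surjective : Function.Surjective ((f.fiberι s).stalkMap y).hom :=
  (f.fiberι s).stalkMap_surjective y

theorem fiberι_stalkMap_eq_zero {a : X.presheaf.stalk (f.fiberι s y)}
    (ha : a ∈ (IsLocalRing.maximalIdeal (S.presheaf.stalk (f (f.fiberι s y)))).map
      (algebraMap _ (X.presheaf.stalk (f.fiberι s y)))) : (f.fiberι s).stalkMap y a = 0 := by
  change a ∈ RingHom.ker ((f.fiberι s).stalkMap y).hom
  refine (Ideal.map_le_iff_le_comap.mpr fun r hr => ?_) ha
  rw [Ideal.mem_comap, RingHom.mem_ker]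
  -- The local ring in question depends on the morphism, so the equality of the two composites to
  -- `S` is used by substitution instead of rewriting.
  have key : ∀ (h h' : f.fiber s ⟶ S), h = h' → ∀ r ∈ IsLocalRing.maximalIdeal (S.presheaf.stalk (h y)),
      (∀ r ∈ IsLocalRing.maximalIdeal (S.presheaf.stalk (h' y)), (h'.stalkMap y).hom r = 0) →
      (h.stalkMap y).hom r = 0 := by
    rintro h _ rfl r hr h1
    exact h1 r hr
  have h2 := key _ _ (f.fiber_fac s) r hr (fun r hr => by
    rw [Scheme.Hom.stalkMap_comp]
    change ((f.fiberToSpecResidueField s).stalkMap y).hom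
      (((S.fromSpecResidueField s).stalkMap (f.fiberToSpecResidueField s y)).hom r) = 0
    have hloc : ∀ x, IsLocalHom ((S.fromSpecResidueField s).stalkMap x).hom := inferInstance
    have h3 : ((S.fromSpecResidueField s).stalkMap (f.fiberToSpecResidueField s y)).hom r = 0 :=
      eq_zero_of_not_isUnit_stalk_Spec _ (Field.toIsField (S.residueField s)) _
        (fun h => (IsLocalRing.mem_maximalIdeal r).mp hr ((hloc _).map_nonunit r h))
    rw [h3, map_zero])
  rw [Scheme.Hom.stalkMap_comp] at h2
  exact h2

/-- The universal property of the fiber, tested on the quotient `Q` of the local ring of `X` by the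
extended maximal ideal: `Spec Q` maps to the fiber with closed point going to `y`. So the projection
to `Q` factors through the local ring of the fiber. -/
theorem mem_map_of_fiberι_stalkMap_eq_zero {a : X.presheaf.stalk (f.fiberι s y)}
    (ha : (f.fiberι s).stalkMap y a = 0) :
    a ∈ (IsLocalRing.maximalIdeal (S.presheaf.stalk (f (f.fiberι s y)))).map
      (algebraMap _ (X.presheaf.stalk (f.fiberι s y))) := by
  let x := f.fiberι s y
  let J := (IsLocalRing.maximalIdeal (S.presheaf.stalk (f x))).map
      (algebraMap _ (X.presheaf.stalk x))
  have hJ : J ≤ IsLocalRing.maximalIdeal (X.presheaf.stalk x) :=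
    Ideal.map_le_iff_le_comap.mpr fun r hr => (IsLocalRing.mem_maximalIdeal _).mpr fun h =>
      (IsLocalRing.mem_maximalIdeal r).mp hr (isUnit_of_map_unit (f.stalkMap x).hom r h)
  have hJ' : J ≠ ⊤ := fun h => (IsLocalRing.maximalIdeal.isMaximal _).ne_top (top_le_iff.mp (h ▸ hJ))
  have : Nontrivial (X.presheaf.stalk x ⧸ J) := Ideal.Quotient.nontrivial_iff.mpr hJ'
  let Q : CommRingCat.{u} := .of (X.presheaf.stalk x ⧸ J)
  have : IsLocalRing Q := IsLocalRing.of_surjective' (Ideal.Quotient.mk J) Ideal.Quotient.mk_surjective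
  let π : X.presheaf.stalk x ⟶ Q := CommRingCat.ofHom (Ideal.Quotient.mk J)
  let ρ : S.residueField (f x) ⟶ Q := CommRingCat.ofHom (Ideal.Quotient.lift
    (IsLocalRing.maximalIdeal (S.presheaf.stalk (f x)))
    ((Ideal.Quotient.mk J).comp (f.stalkMap x).hom) fun r hr =>
      Ideal.Quotient.eq_zero_iff_mem.mpr (Ideal.mem_map_of_mem _ hr))
  have hρ : S.residue (f x) ≫ ρ = f.stalkMap x ≫ π := rfl
  have hs : f x = s := by
    have h : x ∈ f ⁻¹' {s} := f.range_fiberι s ▸ ⟨y, rfl⟩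
    exact h
  have hcomm : (Spec.map π ≫ X.fromSpecStalk x) ≫ f =
      (Spec.map ρ ≫ Spec.map (S.residueFieldCongr hs.symm).hom) ≫ S.fromSpecResidueField s := by
    rw [Category.assoc, Category.assoc, Scheme.residueFieldCongr_fromSpecResidueField,
      ← Scheme.SpecMap_stalkMap_fromSpecStalk, Scheme.fromSpecResidueField,
      ← Spec.map_comp_assoc, ← Spec.map_comp_assoc, hρ]
  let l : Spec Q ⟶ f.fiber s := Limits.pullback.lift _ _ hcomm
  have hl : l ≫ f.fiberι s = Spec.map π ≫ X.fromSpecStalk x := Limits.pullback.lift_fst _ _ hcomm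
  have hly : l (IsLocalRing.closedPoint Q) = y := by
    apply (f.fiberι s).isEmbedding.injective
    have hloc : IsLocalHom π.hom := IsLocalHom.of_surjective _ Ideal.Quotient.mk_surjective
    have h1 : (l ≫ f.fiberι s) (IsLocalRing.closedPoint Q) = x := by
      rw [hl]
      refine Eq.trans (congrArg (X.fromSpecStalk x) ?_) X.fromSpecStalk_closedPoint
      exact IsLocalRing.comap_closedPoint π.hom
    exact h1
  obtain ⟨ψ, hψ⟩ := exists_eq_SpecMap_fromSpecStalk l hly
  rw [hψ, Category.assoc, ← Scheme.SpecMap_stalkMap_fromSpecStalk, ← Spec.map_comp_assoc,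
    cancel_mono] at hl
  have h2 : (f.fiberι s).stalkMap y ≫ ψ = π := Spec.map_injective hl
  have h3 : π.hom a = 0 := by
    rw [← h2, CommRingCat.hom_comp, RingHom.comp_apply]
    exact (congrArg ψ.hom ha).trans (map_zero _)
  exact Ideal.Quotient.eq_zero_iff_mem.mp h3

end fiber

/-! ### The algebraic assertions for the local rings of the quotient. -/

section stalk
variable {X S : Scheme.{u}} {f : X ⟶ S} {F : StalkFamily f}

theorem IsCoherent.fg (hF : IsCoherent F) (x : X) : (F x).FG := by
  obtain ⟨U, hx, n, D, -, h⟩ := hF x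
  rw [h x hx]
  exact Submodule.fg_span (Set.finite_range _)

theorem HasMultiplicativeSingularitiesAt.exists_frame {p : ℕ} {x : X}
    (h : HasMultiplicativeSingularitiesAt p F x) :
    ∃ G, IsMultiplicativeFrame p (maximalIdeal (X.presheaf.stalk x)) (F x) G := by
  obtain ⟨G, h1, h2, h3⟩ := h
  exact ⟨G, h1, h2, h3⟩

variable {p : ℕ} [hpp : Fact p.Prime] (hp : (p : Γ(X, ⊤)) = 0) (hF : IsCoherent F)
  [LocallyOfFiniteType f] [IsLocallyNoetherian S] {x : X}

theorem quotientMap_stalkMap_flat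
    (hx : HasMultiplicativeSingularitiesAt p F x) [Flat f] :
    ((quotientMap F hp hF).stalkMap (quotientProj F hp hF x)).hom.Flat := by
  obtain ⟨G, hG⟩ := hx.exists_frame
  have : LocallyOfFiniteType (quotientMap F hp hF) := locallyOfFiniteType_quotientMap F hp hF
  have : IsLocallyNoetherian (quotient F hp hF) :=
    LocallyOfFiniteType.isLocallyNoetherian (quotientMap F hp hF)
  have : IsLocallyNoetherian X := LocallyOfFiniteType.isLocallyNoetherian f
  let : Algebra (S.presheaf.stalk (f x))
      ((quotient F hp hF).presheaf.stalk (quotientProj F hp hF x)) :=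
    ((quotientMap F hp hF).stalkMap (quotientProj F hp hF x)).hom.toAlgebra
  let : Algebra ((quotient F hp hF).presheaf.stalk (quotientProj F hp hF x))
      (X.presheaf.stalk x) := ((quotientProj F hp hF).stalkMap x).hom.toAlgebra
  have : Module.Finite ((quotient F hp hF).presheaf.stalk (quotientProj F hp hF x))
      (X.presheaf.stalk x) := quotientProj_stalkMap_finite F hp hF x
  have : IsScalarTower (S.presheaf.stalk (f x))
      ((quotient F hp hF).presheaf.stalk (quotientProj F hp hF x)) (X.presheaf.stalk x) :=
    IsScalarTower.of_algebraMap_eq' (congrArg CommRingCat.Hom.hom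
      (Scheme.Hom.stalkMap_comp (quotientProj F hp hF) (quotientMap F hp hF) x))
  have : Module.Flat (S.presheaf.stalk (f x)) (X.presheaf.stalk x) := Flat.stalkMap f x
  exact hG.flat (R := S.presheaf.stalk (f x)) hpp.out.two_le (hF.fg x)
    (exists_quotientProj_stalkMap_eq_iff F hp hF x) (stalk_pow_mem F hp hF x)
    (quotientProj_stalkMap_injective F hp hF x)

theorem exists_sub_stalkMap_mem
    (hx : HasMultiplicativeSingularitiesAt p F x) {a : X.presheaf.stalk x}
    (ha : ∀ D ∈ F x, D a ∈ (maximalIdeal (S.presheaf.stalk (f x))).map (f.stalkMap x).hom) :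
    ∃ b, a - (quotientProj F hp hF).stalkMap x b ∈
      (maximalIdeal (S.presheaf.stalk (f x))).map (f.stalkMap x).hom := by
  obtain ⟨G, hG⟩ := hx.exists_frame
  have : LocallyOfFiniteType (quotientMap F hp hF) := locallyOfFiniteType_quotientMap F hp hF
  have : IsLocallyNoetherian (quotient F hp hF) :=
    LocallyOfFiniteType.isLocallyNoetherian (quotientMap F hp hF)
  have : IsLocallyNoetherian X := LocallyOfFiniteType.isLocallyNoetherian f
  let : Algebra ((quotient F hp hF).presheaf.stalk (quotientProj F hp hF x))
      (X.presheaf.stalk x) := ((quotientProj F hp hF).stalkMap x).hom.toAlgebra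
  have : Module.Finite ((quotient F hp hF).presheaf.stalk (quotientProj F hp hF x))
      (X.presheaf.stalk x) := quotientProj_stalkMap_finite F hp hF x
  exact hG.exists_sub_mem hpp.out.two_le (hF.fg x)
    (exists_quotientProj_stalkMap_eq_iff F hp hF x) (stalk_pow_mem F hp hF x) _ ha

theorem mem_map_of_stalkMap_mem
    (hx : HasMultiplicativeSingularitiesAt p F x)
    {b : (quotient F hp hF).presheaf.stalk (quotientProj F hp hF x)}
    (hb : (quotientProj F hp hF).stalkMap x b ∈
      (maximalIdeal (S.presheaf.stalk (f x))).map (f.stalkMap x).hom) :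
    b ∈ (maximalIdeal (S.presheaf.stalk (quotientMap F hp hF (quotientProj F hp hF x)))).map
      ((quotientMap F hp hF).stalkMap (quotientProj F hp hF x)).hom := by
  obtain ⟨G, hG⟩ := hx.exists_frame
  have : LocallyOfFiniteType (quotientMap F hp hF) := locallyOfFiniteType_quotientMap F hp hF
  have : IsLocallyNoetherian (quotient F hp hF) :=
    LocallyOfFiniteType.isLocallyNoetherian (quotientMap F hp hF)
  have : IsLocallyNoetherian X := LocallyOfFiniteType.isLocallyNoetherian f
  let : Algebra (S.presheaf.stalk (f x))
      ((quotient F hp hF).presheaf.stalk (quotientProj F hp hF x)) :=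
    ((quotientMap F hp hF).stalkMap (quotientProj F hp hF x)).hom.toAlgebra
  let : Algebra ((quotient F hp hF).presheaf.stalk (quotientProj F hp hF x))
      (X.presheaf.stalk x) := ((quotientProj F hp hF).stalkMap x).hom.toAlgebra
  have : Module.Finite ((quotient F hp hF).presheaf.stalk (quotientProj F hp hF x))
      (X.presheaf.stalk x) := quotientProj_stalkMap_finite F hp hF x
  have : IsScalarTower (S.presheaf.stalk (f x))
      ((quotient F hp hF).presheaf.stalk (quotientProj F hp hF x)) (X.presheaf.stalk x) :=
    IsScalarTower.of_algebraMap_eq' (congrArg CommRingCat.Hom.hom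
      (Scheme.Hom.stalkMap_comp (quotientProj F hp hF) (quotientMap F hp hF) x))
  exact hG.mem_map_of_algebraMap_mem (R := S.presheaf.stalk (f x)) hpp.out.two_le (hF.fg x)
    (exists_quotientProj_stalkMap_eq_iff F hp hF x) (stalk_pow_mem F hp hF x)
    (quotientProj_stalkMap_injective F hp hF x) _ hb

end stalk

/-! ### The comparison morphism on points and on local rings. -/

section comparison
variable {X S : Scheme.{u}} {f : X ⟶ S} (F : StalkFamily f) (s : S) {p : ℕ} [hpp : Fact p.Prime]
  (hp : (p : Γ(X, ⊤)) = 0) (hF : IsCoherent F) (hFs : IsCoherent (F.fiber s))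

/-- The quotient morphism of the fiber. -/
noncomputable abbrev fiberProj : f.fiber s ⟶
    quotient (F.fiber s) (natCast_eq_zero_of_hom (f.fiberι s) hp) hFs :=
  quotientProj (F.fiber s) (natCast_eq_zero_of_hom (f.fiberι s) hp) hFs

theorem fiberProj_fiberComparison_fiberι :
    fiberProj F s hp hFs ≫ fiberComparison F s hp hF hFs ≫ (quotientMap F hp hF).fiberι s =
      f.fiberι s ≫ quotientProj F hp hF := by
  have h : fiberComparison F s hp hF hFs ≫ (quotientMap F hp hF).fiberι s =
      quotientDesc (F.fiber s) (natCast_eq_zero_of_hom (f.fiberι s) hp) hFs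
        (f.fiberι s ≫ quotientProj F hp hF) (fiber_app_mem F s hp hF) :=
    Limits.pullback.lift_fst _ _ _
  rw [h]
  rfl

theorem fiberComparison_toSpec :
    fiberComparison F s hp hF hFs ≫ (quotientMap F hp hF).fiberToSpecResidueField s =
      quotientMap (F.fiber s) (natCast_eq_zero_of_hom (f.fiberι s) hp) hFs :=
  Limits.pullback.lift_snd _ _ _

/-- Both quotient morphisms are the identity on points, so this reduces to the injectivity of the
inclusion of the fiber in `X`. -/
theorem fiberComparison_injective : Function.Injective (fiberComparison F s hp hF hFs) := by
  intro y y' h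
  have h1 : ∀ y : f.fiber s, (quotientMap F hp hF).fiberι s
      (fiberComparison F s hp hF hFs (fiberProj F s hp hFs y)) = f.fiberι s y :=
    fun y => congr($(fiberProj_fiberComparison_fiberι F s hp hF hFs) y)
  have h2 := (h1 y).symm.trans ((congrArg ((quotientMap F hp hF).fiberι s) h).trans (h1 y'))
  exact (f.fiberι s).isEmbedding.injective h2

theorem locallyOfFiniteType_fiberComparison [LocallyOfFiniteType f] :
    LocallyOfFiniteType (fiberComparison F s hp hF hFs) := by
  have : LocallyOfFiniteType (f.fiberToSpecResidueField s) :=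
    inferInstanceAs (LocallyOfFiniteType (Limits.pullback.snd f (S.fromSpecResidueField s)))
  have h : LocallyOfFiniteType (fiberComparison F s hp hF hFs ≫
      (quotientMap F hp hF).fiberToSpecResidueField s) := by
    rw [fiberComparison_toSpec]
    exact locallyOfFiniteType_quotientMap _ _ _
  exact locallyOfFiniteType_of_comp _ ((quotientMap F hp hF).fiberToSpecResidueField s)

variable [LocallyOfFiniteType f] [IsLocallyNoetherian S] {s} {y : f.fiber s}

/-- Every element of `F` restricts to the fiber, by compatibility of the tangent sheaf with fibers.
Hence a lift of `a'` to `X` is killed by `F` modulo the maximal ideal of the base, and can be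
corrected to an invariant. -/
theorem exists_stalkMap_eq_of_mem_invariants
    (hy : HasMultiplicativeSingularitiesAt p F (f.fiberι s y)) (hT : TangentCommutesWithFibers f)
    {a' : (f.fiber s).presheaf.stalk y} (ha' : ∀ D ∈ F.fiber s y, D a' = 0) :
    ∃ b, ((f.fiberι s ≫ quotientProj F hp hF).stalkMap y).hom b = a' := by
  obtain ⟨a, rfl⟩ := fiberι_stalkMap_surjective f s y a'
  obtain ⟨e, he⟩ := hT s y
  obtain ⟨b, hb⟩ := exists_sub_stalkMap_mem hp hF hy (a := a) fun D hD =>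
    mem_map_of_fiberι_stalkMap_eq_zero f s y
      ((he D a).symm.trans (ha' _ (Submodule.subset_span ⟨D, hD, he D⟩)))
  refine ⟨b, ?_⟩
  have h := fiberι_stalkMap_eq_zero f s y hb
  rw [map_sub, sub_eq_zero] at h
  rw [Scheme.Hom.stalkMap_comp]
  exact h.symm

theorem mem_map_of_stalkMap_eq_zero
    (hy : HasMultiplicativeSingularitiesAt p F (f.fiberι s y))
    {b : (quotient F hp hF).presheaf.stalk ((f.fiberι s ≫ quotientProj F hp hF) y)}
    (hb : ((f.fiberι s ≫ quotientProj F hp hF).stalkMap y).hom b = 0) :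
    b ∈ (maximalIdeal (S.presheaf.stalk (quotientMap F hp hF
      ((f.fiberι s ≫ quotientProj F hp hF) y)))).map
      ((quotientMap F hp hF).stalkMap ((f.fiberι s ≫ quotientProj F hp hF) y)).hom := by
  rw [Scheme.Hom.stalkMap_comp] at hb
  exact mem_map_of_stalkMap_mem hp hF hy (mem_map_of_fiberι_stalkMap_eq_zero f s y hb)

/-- The local ring of `X / F` surjects onto that of its fiber, and the local ring of the quotient of
the fiber embeds in that of the fiber of `X`. Both halves of bijectivity thus become statements
about the map from the local ring of `X / F` to that of the fiber of `X`: its kernel and its image.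
-/
theorem isIso_stalkMap_fiberComparison
    (hy : HasMultiplicativeSingularitiesAt p F (f.fiberι s y)) (hT : TangentCommutesWithFibers f) :
    IsIso ((fiberComparison F s hp hF hFs).stalkMap (fiberProj F s hp hFs y)) := by
  have hcomp := fiberProj_fiberComparison_fiberι F s hp hF hFs
  have hst : ∀ b, ((fiberProj F s hp hFs ≫ fiberComparison F s hp hF hFs ≫
      (quotientMap F hp hF).fiberι s).stalkMap y).hom b =
      (fiberProj F s hp hFs).stalkMap y ((fiberComparison F s hp hF hFs).stalkMap _
        (((quotientMap F hp hF).fiberι s).stalkMap _ b)) := by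
    intro b
    rw [Scheme.Hom.stalkMap_comp, Scheme.Hom.stalkMap_comp]
    rfl
  rw [ConcreteCategory.isIso_iff_bijective]
  constructor
  · refine (injective_iff_map_eq_zero
      ((fiberComparison F s hp hF hFs).stalkMap (fiberProj F s hp hFs y)).hom).mpr fun c hc => ?_
    obtain ⟨b, rfl⟩ := fiberι_stalkMap_surjective (quotientMap F hp hF) s _ c
    have key : ∀ h : f.fiber s ⟶ quotient F hp hF, h = f.fiberι s ≫ quotientProj F hp hF →
        ∀ b, (h.stalkMap y).hom b = 0 →
          b ∈ (maximalIdeal (S.presheaf.stalk (quotientMap F hp hF (h y)))).map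
            ((quotientMap F hp hF).stalkMap (h y)).hom := by
      rintro _ rfl b hb
      exact mem_map_of_stalkMap_eq_zero F hp hF hy hb
    refine fiberι_stalkMap_eq_zero (quotientMap F hp hF) s _ (key _ hcomp b ?_)
    refine (hst b).trans ?_
    exact (congrArg ((fiberProj F s hp hFs).stalkMap y).hom hc).trans (map_zero _)
  · intro c
    have key : ∀ h : f.fiber s ⟶ quotient F hp hF, h = f.fiberι s ≫ quotientProj F hp hF →
        ∃ b, (h.stalkMap y).hom b = (fiberProj F s hp hFs).stalkMap y c := by
      rintro _ rfl
      exact exists_stalkMap_eq_of_mem_invariants F hp hF hy hT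
        ((exists_quotientProj_stalkMap_eq_iff (F.fiber s) _ hFs y _).mp ⟨c, rfl⟩)
    obtain ⟨b, hb⟩ := key _ hcomp
    exact ⟨_, quotientProj_stalkMap_injective (F.fiber s) _ hFs y ((hst b).symm.trans hb)⟩

theorem isIsoAt_fiberComparison
    (hy : HasMultiplicativeSingularitiesAt p F (f.fiberι s y)) (hT : TangentCommutesWithFibers f) :
    IsIsoAt (fiberComparison F s hp hF hFs) (fiberProj F s hp hFs y) := by
  have := locallyOfFiniteType_fiberComparison F s hp hF hFs
  have := locallyOfFiniteType_quotientMap F hp hF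
  have : LocallyOfFiniteType ((quotientMap F hp hF).fiberToSpecResidueField s) :=
    inferInstanceAs (LocallyOfFiniteType (Limits.pullback.snd (quotientMap F hp hF)
      (S.fromSpecResidueField s)))
  have : IsLocallyNoetherian ((quotientMap F hp hF).fiber s) :=
    LocallyOfFiniteType.isLocallyNoetherian ((quotientMap F hp hF).fiberToSpecResidueField s)
  have := isIso_stalkMap_fiberComparison F hp hF hFs hy hT
  exact isIsoAt_of_isIso_stalkMap _ (fiberComparison_injective F s hp hF hFs) _

end comparison
end Foliation

open Foliation
theorem mainTheorem10 {p : ℕ} [Fact p.Prime] {k : Type u} [Field k] [CharP k p] [PerfectField k]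
    {X S : Scheme.{u}} (σ : S ⟶ Spec (.of k)) (f : X ⟶ S) (r : ℕ) (F : StalkFamily f)
    (hF : IsFamilyOfOneFoliations p r f F) (hS : IsRegularScheme S) (z : X)
    (hz : IsClosed ({z} : Set X)) (hmult : HasMultiplicativeSingularitiesAt p F z) :
    ((quotientMap F (natCast_eq_zero_of_hom f (natCast_eq_zero_of_charP σ))
        hF.coherent).stalkMap
      (quotientProj F (natCast_eq_zero_of_hom f (natCast_eq_zero_of_charP σ))
        hF.coherent z)).hom.Flat ∧
    IsIsoAt
      (fiberComparison F (f z) (natCast_eq_zero_of_hom f (natCast_eq_zero_of_charP σ))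
        hF.coherent (hF.fiber (f z)).coherent)
      (quotientProj (F.fiber (f z))
        (natCast_eq_zero_of_hom (f.fiberι (f z))
          (natCast_eq_zero_of_hom f (natCast_eq_zero_of_charP σ)))
        (hF.fiber (f z)).coherent (f.asFiber z)) := by
  have := hF.locallyNoetherian
  have := hF.flat
  have := hF.locallyOfFiniteType
  have hy : HasMultiplicativeSingularitiesAt p F (f.fiberι (f z) (f.asFiber z)) := by
    rw [Scheme.Hom.fiberι_asFiber]
    exact hmult
  exact ⟨quotientMap_stalkMap_flat _ _ hmult,
    isIsoAt_fiberComparison F _ _ _ hy hF.tangent_fiber⟩
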